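/- Let $1<p<\infty$ and $m\in\mathbb N$. Let $L^p_m(\mathbb T)$ and $H^p_m$ denote the spaces of vector functions of length $m$ with entries in $L^p$ of the unit circle $\mathbb T$ and in the Hardy space $H^p$ of the unit disc, let $\mathbb P$ be the Riesz projection of $L^p_m(\mathbb T)$ onto $H^p_m$, and let $\mathrm{Rat}_0^m(\mathbb T)$ be the set of strictly proper rational vector functions of length $m$ with poles only on $\mathbb T$. For an $m\times m$ rational matrix function $\Omega$, possibly with poles on $\mathbb T$, let $T_\Omega(H^p_m\to H^p_m)$ be the unbounded operator $$\mathrm{Dom}(T_\Omega)=\{f\in H^p_m:\ \Omega f=h+r \text{ with } h\in L^p_m(\mathbb T),\ r\in \mathrm{Rat}_0^m(\mathbb T)\},\qquad T_\Omega f=\mathbb P h.$$ Let $(a_j)_{j\in\mathbb Z}$ be a sequence of complex $m\times m$ matrices, and let $\|\cdot\|$ be the operator norm. The semi-infinite block Toeplitz matrix $[a_{i-j}]_{i,j=0}^\infty$ is the matrix representation of $T_\Omega$ with respect to the standard block basis of $H^p_m$ for some $m\times m$ rational matrix function $\Omega$ (that is, for all $j\ge 0$ and $w\in\mathbb C^m$,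 $z^jw\in\mathrm{Dom}(T_\Omega)$ and $T_\Omega(z^jw)$ has Taylor coefficients $a_{i-j}w$, $i\ge0$) if and only if the following three conditions hold: 1. $\|a_0\|,\|a_1\|,\|a_2\|,\dots$ are the Taylor coefficients at $0$ of a function in $H^p$; 2. there are an integer $M\ge 1$ and a real $K>0$ such that $\|a_{-j}\|\le K\binom{j}{M-1}$ for all integers $j\ge 1$ with $j\ge M-1$; 3. the ranks of the block Hankel matrices $H_k^+=[a_{r+s-1}]_{r,s=1}^k$ and $H_k^-=[a_{-(r+s-1)}]_{r,s=1}^k$ are bounded uniformly in $k\ge 1$. -/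

import Mathlib

open MeasureTheory Filter Topology
open scoped ENNReal Polynomial Matrix Matrix.Norms.L2Operator

noncomputable section

namespace ToeplitzLike

/-! ### The circle, `L^p` and `H^p` -/

/-- The unit circle `𝕋`, parametrized by `t ↦ exp (2πit)`, with normalized arc length
measure `arc`. -/
abbrev arc : Measure UnitAddCircle := AddCircle.haarAddCircle

/-- The point `exp (2πit)` of the unit circle. -/
def pt (t : UnitAddCircle) : ℂ := (AddCircle.toCircle t : ℂ)

/-- The scalar space `L^p(𝕋)`. -/
abbrev LpT (p : ℝ≥0∞) : Type := Lp ℂ p arc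

/-- Fourier coefficients of a function in `L^p(𝕋)`. -/
def fcoeff {p : ℝ≥0∞} (f : LpT p) (n : ℤ) : ℂ := fourierCoeff (f : UnitAddCircle → ℂ) n

theorem fcoeff_add {p : ℝ≥0∞} [Fact (1 ≤ p)] (f g : LpT p) (n : ℤ) :
    fcoeff (f + g) n = fcoeff f n + fcoeff g n := by
  have hf : Integrable f arc := (Lp.memLp f).integrable Fact.out
  have hg : Integrable g arc := (Lp.memLp g).integrable Fact.out
  unfold fcoeff
  rw [fourierCoeff_congr_ae (Lp.coeFn_add f g), fourierCoeff.add hf hg, Pi.add_apply]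

theorem fcoeff_smul {p : ℝ≥0∞} (c : ℂ) (f : LpT p) (n : ℤ) :
    fcoeff (c • f) n = c * fcoeff f n := by
  unfold fcoeff
  rw [fourierCoeff_congr_ae (Lp.coeFn_smul c f), fourierCoeff.const_smul, smul_eq_mul]

theorem fcoeff_zero {p : ℝ≥0∞} (n : ℤ) : fcoeff (0 : LpT p) n = 0 := by
  have := fcoeff_smul (0 : ℂ) (0 : LpT p) n
  simpa using this

/-- A function in `L^p(𝕋)` all of whose Fourier coefficients vanish is zero. -/
theorem eq_zero_of_fcoeff {p : ℝ≥0∞} [Fact (1 ≤ p)] (f : LpT p) (hf : ∀ n, fcoeff f n = 0) :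
    f = 0 := by
  have hi : Integrable f arc := (Lp.memLp f).integrable Fact.out
  have hm : ∀ φ : C(UnitAddCircle, ℂ), Integrable (fun t => φ t * f t) arc := fun φ =>
    hi.bdd_mul (c := ‖φ‖) φ.continuous.aestronglyMeasurable
      (Eventually.of_forall φ.norm_coe_le_norm)
  let L : C(UnitAddCircle, ℂ) →ₗ[ℂ] ℂ :=
    { toFun := fun φ => ∫ t, φ t * f t ∂arc
      map_add' := fun φ ψ => by
        rw [← integral_add (hm φ) (hm ψ)]
        exact integral_congr_ae (Eventually.of_forall fun t => by simp [add_mul])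
      map_smul' := fun c φ => by
        rw [RingHom.id_apply, smul_eq_mul, ← integral_const_mul]
        exact integral_congr_ae (Eventually.of_forall fun t => by simp [mul_assoc]) }
  have hL : ∀ φ, ‖L φ‖ ≤ (∫ t, ‖f t‖ ∂arc) * ‖φ‖ := by
    intro φ
    rw [mul_comm, ← integral_const_mul]
    refine norm_integral_le_of_norm_le (hi.norm.const_mul _) (Eventually.of_forall fun t => ?_)
    rw [norm_mul]
    exact mul_le_mul_of_nonneg_right (φ.norm_coe_le_norm t) (norm_nonneg _)
  let L' : C(UnitAddCircle, ℂ) →L[ℂ] ℂ := L.mkContinuous _ hL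
  have hker : ∀ φ : C(UnitAddCircle, ℂ), ∫ t, φ t * f t ∂arc = 0 := by
    have h1 : (Submodule.span ℂ (Set.range (@fourier 1))).topologicalClosure
        ≤ LinearMap.ker L'.toLinearMap := by
      refine Submodule.topologicalClosure_minimal _ ?_ L'.isClosed_ker
      rw [Submodule.span_le]
      rintro _ ⟨n, rfl⟩
      have h2 := hf (-n)
      rw [fcoeff, fourierCoeff, neg_neg] at h2
      exact h2
    rw [span_fourier_closure_eq_top] at h1
    exact fun φ => h1 (Submodule.mem_top (x := φ))
  have hae : (f : UnitAddCircle → ℂ) =ᵐ[arc] 0 := by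
    refine ae_eq_zero_of_forall_setIntegral_isClosed_eq_zero hi (fun s hs => ?_)
    have h3 : ∀ n : ℕ, ∫ t, ((hs.apprSeq n t : ℝ) : ℂ) * f t ∂arc = 0 := fun n =>
      hker ⟨fun t => ((hs.apprSeq n t : ℝ) : ℂ), by fun_prop⟩
    have h4 : Tendsto (fun n : ℕ => ∫ t, ((hs.apprSeq n t : ℝ) : ℂ) * f t ∂arc) atTop
        (𝓝 (∫ t, s.indicator f t ∂arc)) := by
      refine tendsto_integral_of_dominated_convergence (fun t => ‖f t‖) ?_ hi.norm ?_ ?_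
      · intro n
        exact (hm ⟨fun t => ((hs.apprSeq n t : ℝ) : ℂ), by fun_prop⟩).aestronglyMeasurable
      · intro n
        refine Eventually.of_forall fun t => ?_
        have h5 : ((hs.apprSeq n t : ℝ)) ≤ 1 := by
          exact_mod_cast HasOuterApproxClosed.apprSeq_apply_le_one hs n t
        rw [norm_mul, Complex.norm_real, Real.norm_of_nonneg (NNReal.coe_nonneg _)]
        exact mul_le_of_le_one_left (norm_nonneg _) h5
      · refine Eventually.of_forall fun t => ?_
        have h6 := (tendsto_pi_nhds.1 (HasOuterApproxClosed.tendsto_apprSeq hs)) t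
        have h7 : Tendsto (fun n : ℕ => ((hs.apprSeq n t : ℝ) : ℂ)) atTop
            (𝓝 (((s.indicator (fun _ => (1 : NNReal)) t : NNReal) : ℝ) : ℂ)) :=
          (Complex.continuous_ofReal.tendsto _).comp ((NNReal.continuous_coe.tendsto _).comp h6)
        have h8 := h7.mul_const (f t)
        convert h8 using 2
        by_cases ht : t ∈ s <;> simp [ht]
    simp only [h3] at h4
    rw [← integral_indicator hs.measurableSet]
    exact (tendsto_nhds_unique h4 tendsto_const_nhds)
  exact Lp.eq_zero_iff_ae_eq_zero.2 hae

/-- The Hardy space `H^p`, identified through boundary values with the functions in `L^p(𝕋)`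
whose Fourier coefficients of negative index vanish. For `f` in `H^p` the Taylor coefficients
at `0` of its analytic extension to the disc are the Fourier coefficients `fcoeff f n`, `n ≥ 0`. -/
def Hardy (p : ℝ≥0∞) [Fact (1 ≤ p)] : Submodule ℂ (LpT p) where
  carrier := {f | ∀ n : ℤ, n < 0 → fcoeff f n = 0}
  add_mem' := by
    intro f g hf hg n hn
    rw [fcoeff_add, hf n hn, hg n hn, add_zero]
  zero_mem' := fun n _ => fcoeff_zero n
  smul_mem' := by
    intro c f hf n hn
    rw [fcoeff_smul, hf n hn, mul_zero]

/-- The space `H^p_m` of vectors of length `m` with entries in `H^p`. -/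
abbrev HardyVec (p : ℝ≥0∞) [Fact (1 ≤ p)] (m : ℕ) : Type := Fin m → Hardy p

/-- The function `z ^ n` in `H^p`. -/
def zpowH (p : ℝ≥0∞) [Fact (1 ≤ p)] (n : ℕ) : Hardy p :=
  ⟨fourierLp p (n : ℤ), by
    intro k hk
    unfold fcoeff
    rw [fourierCoeff_congr_ae (coeFn_fourierLp p (n : ℤ)), fourierCoeff_fourier,
      Pi.single_apply, if_neg (by omega)]⟩

/-- The vector function `z ^ n w` in `H^p_m`, for a vector `w` in `ℂ^m`. -/
def monomialVec (p : ℝ≥0∞) [Fact (1 ≤ p)] {m : ℕ} (n : ℕ) (w : Fin m → ℂ) : HardyVec p m :=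
  fun i => w i • zpowH p n

/-! ### Rational functions on the circle -/

/-- The value of a rational function at a point of `ℂ` (in lowest terms; poles play no role
below, as a rational function has only finitely many of them). -/
def reval (r : RatFunc ℂ) (z : ℂ) : ℂ := r.eval (RingHom.id ℂ) z

theorem arc_singleton (x : UnitAddCircle) : arc {x} = 0 := by
  have h := AddCircle.volume_closedBall (T := (1 : ℝ)) (x := x) 0
  rw [Metric.closedBall_zero, AddCircle.volume_eq_smul_haarAddCircle] at h
  simpa using h

theorem ae_denom_ne_zero (d : ℂ[X]) (hd : d ≠ 0) :
    ∀ᵐ t ∂arc, d.eval₂ (RingHom.id ℂ) (pt t) ≠ 0 := by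
  have hinj : Function.Injective pt := fun s t h =>
    AddCircle.injective_toCircle one_ne_zero (Subtype.coe_injective h)
  have hfin : {t : UnitAddCircle | d.eval₂ (RingHom.id ℂ) (pt t) = 0}.Finite := by
    have h1 := (d.roots.toFinset.finite_toSet).preimage (f := pt) hinj.injOn
    refine h1.subset (fun t ht => ?_)
    have ht' : d.eval (pt t) = 0 := ht
    simp [Polynomial.IsRoot, hd, ht']
  have h0 : arc {t : UnitAddCircle | d.eval₂ (RingHom.id ℂ) (pt t) = 0} = 0 := by
    rw [← Set.biUnion_of_singleton {t : UnitAddCircle | d.eval₂ (RingHom.id ℂ) (pt t) = 0}]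
    exact (measure_biUnion_null_iff hfin.countable).2 (fun x _ => arc_singleton x)
  rw [ae_iff]
  simpa only [ne_eq, not_not] using h0

theorem reval_add_ae (r s : RatFunc ℂ) :
    ∀ᵐ t ∂arc, reval (r + s) (pt t) = reval r (pt t) + reval s (pt t) := by
  filter_upwards [ae_denom_ne_zero _ r.denom_ne_zero, ae_denom_ne_zero _ s.denom_ne_zero]
    with t h1 h2
  exact RatFunc.eval_add _ _ h1 h2

theorem reval_C_mul_ae (c : ℂ) (r : RatFunc ℂ) :
    ∀ᵐ t ∂arc, reval (RatFunc.C c * r) (pt t) = c * reval r (pt t) := by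
  filter_upwards [ae_denom_ne_zero _ r.denom_ne_zero,
    ae_denom_ne_zero _ (RatFunc.C c).denom_ne_zero] with t h1 h2
  unfold reval
  rw [RatFunc.eval_mul _ _ h2 h1, RatFunc.eval_C, RingHom.id_apply]

/-- `Rat_0(𝕋)`: the strictly proper rational functions all of whose poles lie on the
unit circle. -/
def IsRatZeroCircle (r : RatFunc ℂ) : Prop :=
  r.num.degree < r.denom.degree ∧ ∀ z : ℂ, r.denom.IsRoot z → ‖z‖ = 1

theorem degree_num_lt (r : RatFunc ℂ) {q d : ℂ[X]} (hd : d ≠ 0)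
    (h : r.num * d = q * r.denom) (hq : q.degree < d.degree) :
    r.num.degree < r.denom.degree := by
  by_cases hn : r.num = 0
  · rw [hn, Polynomial.degree_zero, bot_lt_iff_ne_bot, ne_eq, Polynomial.degree_eq_bot]
    exact r.denom_ne_zero
  have hq0 : q ≠ 0 := by
    rintro rfl
    rw [zero_mul] at h
    exact (mul_ne_zero hn hd) h
  have h' := congrArg Polynomial.natDegree h
  rw [Polynomial.natDegree_mul hn hd, Polynomial.natDegree_mul hq0 r.denom_ne_zero] at h'
  have hq' := Polynomial.natDegree_lt_natDegree hq0 hq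
  rw [Polynomial.degree_eq_natDegree hn, Polynomial.degree_eq_natDegree r.denom_ne_zero]
  exact_mod_cast (by omega : r.num.natDegree < r.denom.natDegree)

theorem IsRatZeroCircle.zero : IsRatZeroCircle 0 := by
  constructor
  · simp
  · intro z hz
    simp at hz

theorem IsRatZeroCircle.add {r s : RatFunc ℂ} (hr : IsRatZeroCircle r)
    (hs : IsRatZeroCircle s) : IsRatZeroCircle (r + s) := by
  constructor
  · refine degree_num_lt (r + s) (mul_ne_zero r.denom_ne_zero s.denom_ne_zero)
      (RatFunc.num_denom_add r s) (lt_of_le_of_lt (Polynomial.degree_add_le _ _) (max_lt ?_ ?_))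
    · rw [Polynomial.degree_mul, Polynomial.degree_mul]
      rw [Polynomial.degree_eq_natDegree s.denom_ne_zero]
      exact WithBot.add_lt_add_right WithBot.coe_ne_bot hr.1
    · rw [Polynomial.degree_mul, Polynomial.degree_mul]
      rw [Polynomial.degree_eq_natDegree r.denom_ne_zero]
      exact WithBot.add_lt_add_left WithBot.coe_ne_bot hs.1
  · intro z hz
    have h := hz.dvd (RatFunc.denom_add_dvd r s)
    rw [Polynomial.IsRoot, Polynomial.eval_mul, mul_eq_zero] at h
    exact h.elim (hr.2 z) (hs.2 z)

theorem IsRatZeroCircle.C_mul {r : RatFunc ℂ} (c : ℂ) (hr : IsRatZeroCircle r) :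
    IsRatZeroCircle (RatFunc.C c * r) := by
  constructor
  · refine degree_num_lt _ (mul_ne_zero (RatFunc.C c).denom_ne_zero r.denom_ne_zero)
      (RatFunc.num_denom_mul (RatFunc.C c) r) ?_
    rw [RatFunc.num_C, RatFunc.denom_C, one_mul]
    refine lt_of_le_of_lt ?_ hr.1
    rw [← Polynomial.smul_eq_C_mul]
    exact Polynomial.degree_smul_le c _
  · intro z hz
    have h := hz.dvd (RatFunc.denom_mul_dvd (RatFunc.C c) r)
    rw [RatFunc.denom_C, one_mul] at h
    exact hr.2 z h

/-- A function in `Rat_0(𝕋)` that agrees a.e. with a function in `L^p(𝕋)` vanishes. -/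
theorem IsRatZeroCircle.eq_zero_of_ae {p : ℝ≥0∞} [Fact (1 ≤ p)] {r : RatFunc ℂ}
    (hr : IsRatZeroCircle r) (h : LpT p) (he : ∀ᵐ t ∂arc, h t + reval r (pt t) = 0) : r = 0 := by
  by_cases hdeg : r.denom.degree = 0
  · have h1 := hr.1
    have h2 : r.num = 0 := by
      by_contra h3
      rw [hdeg, Polynomial.degree_eq_natDegree h3] at h1
      exact absurd h1 (by simp)
    exact RatFunc.num_eq_zero_iff.1 h2
  exfalso
  obtain ⟨ζ, hζ⟩ := IsAlgClosed.exists_root r.denom hdeg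
  have hζ1 : ‖ζ‖ = 1 := hr.2 ζ hζ
  have hpt : ∀ x : ℝ, pt (x : UnitAddCircle) = Complex.exp (2 * Real.pi * x * Complex.I) := by
    intro x
    rw [pt, AddCircle.toCircle_apply_mk, Circle.coe_exp]
    push_cast
    ring_nf
  obtain ⟨c, hc⟩ : ∃ c : ℝ, pt (c : UnitAddCircle) = ζ := by
    refine ⟨ζ.arg / (2 * Real.pi), ?_⟩
    have h3 := Complex.norm_mul_exp_arg_mul_I ζ
    rw [hζ1, Complex.ofReal_one, one_mul] at h3
    have hpi : (Real.pi : ℂ) ≠ 0 := by exact_mod_cast Real.pi_ne_zero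
    rw [hpt]
    refine Eq.trans (congrArg Complex.exp ?_) h3
    push_cast
    field_simp
  have hder : HasDerivAt (fun x : ℝ => pt (x : UnitAddCircle)) (2 * Real.pi * Complex.I * ζ) c := by
    have h4 : HasDerivAt (fun x : ℝ => Complex.exp (2 * Real.pi * (x : ℂ) * Complex.I))
        (Complex.exp (2 * Real.pi * (c : ℂ) * Complex.I) * (2 * Real.pi * 1 * Complex.I)) c :=
      (((HasDerivAt.ofReal_comp (hasDerivAt_id c)).const_mul _).mul_const _).cexp
    rw [← hpt, hc] at h4
    convert h4 using 1
    · funext x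
      exact hpt x
    · ring
  have hζ0 : ζ ≠ 0 := by
    rintro rfl
    simp at hζ1
  have hder0 : 2 * (Real.pi : ℂ) * Complex.I * ζ ≠ 0 := by
    simp [hζ0, Real.pi_ne_zero]
  have hne : ∀ᶠ x : ℝ in 𝓝[≠] c, r.denom.eval (pt (x : UnitAddCircle)) ≠ 0 := by
    have h5 : ∀ᶠ x : ℝ in 𝓝[≠] c, ∀ z ∈ r.denom.roots.toFinset,
        pt (x : UnitAddCircle) ≠ z :=
      (Finset.eventually_all _).2 (fun z _ => hder.eventually_ne hder0)
    filter_upwards [h5] with x hx h6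
    exact hx _ (by simpa [r.denom_ne_zero] using h6) rfl
  have hnum : r.num.eval ζ ≠ 0 := by
    intro h7
    obtain ⟨u, v, huv⟩ := r.isCoprime_num_denom
    have h8 := congrArg (Polynomial.eval ζ) huv
    rw [Polynomial.IsRoot] at hζ
    simp [h7, hζ] at h8
  have hdO : (fun x : ℝ => r.denom.eval (pt (x : UnitAddCircle))) =O[𝓝 c]
      (fun x : ℝ => x - c) := by
    have h9 : HasDerivAt (fun x : ℝ => r.denom.eval (pt (x : UnitAddCircle)))
        (r.denom.derivative.eval (pt (c : UnitAddCircle)) * (2 * Real.pi * Complex.I * ζ)) c :=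
      HasDerivAt.comp (h₂ := fun z : ℂ => r.denom.eval z) c (r.denom.hasDerivAt _) hder
    have h10 := h9.differentiableAt.isBigO_sub
    have h11 : r.denom.eval (pt (c : UnitAddCircle)) = 0 := by rw [hc]; exact hζ
    simpa [h11] using h10
  have hnO : (fun _ : ℝ => (1 : ℂ)) =O[𝓝 c]
      (fun x : ℝ => r.num.eval (pt (x : UnitAddCircle))) := by
    have h12 : ContinuousAt (fun x : ℝ => r.num.eval (pt (x : UnitAddCircle))) c :=
      ContinuousAt.comp (g := fun z : ℂ => r.num.eval z) r.num.continuous.continuousAt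
        hder.continuousAt
    refine Asymptotics.isBigO_const_left_iff_pos_le_norm one_ne_zero |>.2 ?_
    have h13 : 0 < ‖r.num.eval (pt (c : UnitAddCircle))‖ := by
      rw [hc]
      exact norm_pos_iff.2 hnum
    refine ⟨_, half_pos h13, ?_⟩
    filter_upwards [h12.norm.eventually (lt_mem_nhds (half_lt_self h13))] with x hx
    exact hx.le
  have hO : (fun x : ℝ => (x - c)⁻¹) =O[𝓝[≠] c]
      (fun x : ℝ => reval r (pt (x : UnitAddCircle))) := by
    have h14 : (fun x : ℝ => (x - c)⁻¹) =O[𝓝[≠] c]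
        (fun x : ℝ => (r.denom.eval (pt (x : UnitAddCircle)))⁻¹) := by
      refine (hdO.mono nhdsWithin_le_nhds).inv_rev ?_
      filter_upwards [hne] with x hx h15
      exact absurd h15 hx
    have h15 : (fun x : ℝ => (((x - c)⁻¹ : ℝ) : ℂ)) =O[𝓝[≠] c]
        (fun x : ℝ => (r.denom.eval (pt (x : UnitAddCircle)))⁻¹) := by
      rw [← Asymptotics.isBigO_norm_left]
      simpa only [Complex.norm_real] using h14.norm_left
    have h16 := ((hnO.mono (nhdsWithin_le_nhds (s := {c}ᶜ))).mul h15).norm_left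
    simp only [one_mul, Complex.norm_real] at h16
    exact h16.of_norm_left
  have hint : Integrable (fun t => reval r (pt t)) (volume : Measure UnitAddCircle) := by
    have h17 : Integrable (fun t => reval r (pt t)) arc := by
      refine ((Lp.memLp h).integrable Fact.out).neg.congr ?_
      filter_upwards [he] with t ht
      simpa using (eq_neg_of_add_eq_zero_right ht).symm
    rw [AddCircle.volume_eq_smul_haarAddCircle]
    exact h17.smul_measure (by simp)
  have hint' : IntervalIntegrable (fun x : ℝ => reval r (pt (x : UnitAddCircle))) volume
      c (c + 1) := by
    rw [intervalIntegrable_iff_integrableOn_Ioc_of_le (by linarith)]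
    exact (UnitAddCircle.measurePreserving_mk c).integrable_comp_of_integrable hint
  exact not_intervalIntegrable_of_sub_inv_isBigO_punctured hO (by linarith [lt_add_one c])
    Set.left_mem_uIcc hint'

/-! ### The operator `T_Ω` -/

/-- `g ∈ H^p` is the Riesz projection `P h` of `h ∈ L^p(𝕋)`, that is, `h - g` has only Fourier
coefficients of negative index. -/
def IsRieszProj {p : ℝ≥0∞} [Fact (1 ≤ p)] (h : LpT p) (g : Hardy p) : Prop :=
  ∀ n : ℤ, 0 ≤ n → fcoeff (g : LpT p) n = fcoeff h n

/-- The graph of the Toeplitz-like operator `T_Ω`: the pairs `(f, P h)` with `f ∈ H^p_m` such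
that `Ω f = h + r` on `𝕋` with `h ∈ L^p_m(𝕋)` and `r ∈ Rat_0^m(𝕋)`. For `1 < p < ∞` every
`h ∈ L^p(𝕋)` has a Riesz projection in `H^p`, so the existence of `P h` does not restrict `f`. -/
def toeplitzGraph (p : ℝ≥0∞) [Fact (1 ≤ p)] {m : ℕ} (Ω : Matrix (Fin m) (Fin m) (RatFunc ℂ)) :
    Submodule ℂ (HardyVec p m × HardyVec p m) where
  carrier := {x | ∃ (h : Fin m → LpT p) (r : Fin m → RatFunc ℂ),
    (∀ i, IsRatZeroCircle (r i)) ∧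
    (∀ i, ∀ᵐ t ∂arc, ∑ j, reval (Ω i j) (pt t) * (x.1 j : LpT p) t =
      h i t + reval (r i) (pt t)) ∧
    ∀ i, IsRieszProj (h i) (x.2 i)}
  add_mem' := by
    rintro ⟨f, g⟩ ⟨f', g'⟩ ⟨h, r, hr, he, hg⟩ ⟨h', r', hr', he', hg'⟩
    refine ⟨h + h', r + r', fun i => (hr i).add (hr' i), fun i => ?_, fun i n hn => ?_⟩
    · have hf : ∀ᵐ t ∂arc, ∀ j, ((f j + f' j : Hardy p) : LpT p) t
          = (f j : LpT p) t + (f' j : LpT p) t := by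
        rw [ae_all_iff]
        intro j
        filter_upwards [Lp.coeFn_add (f j : LpT p) (f' j : LpT p)] with t ht
        simpa using ht
      filter_upwards [he i, he' i, hf, Lp.coeFn_add (h i) (h' i), reval_add_ae (r i) (r' i)]
        with t h1 h2 h3 h4 h5
      simp only [Prod.mk_add_mk, Pi.add_apply] at h1 h2 h4 ⊢
      rw [h4, h5, Finset.sum_congr rfl (fun j _ => by rw [h3 j, mul_add]),
        Finset.sum_add_distrib, h1, h2]
      ring
    · have h1 := hg i n hn
      have h2 := hg' i n hn
      simp only [Prod.mk_add_mk, Pi.add_apply, Submodule.coe_add] at h1 h2 ⊢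
      rw [fcoeff_add, fcoeff_add, h1, h2]
  zero_mem' := by
    refine ⟨0, 0, fun i => IsRatZeroCircle.zero, fun i => ?_, fun i n _ => ?_⟩
    · refine Eventually.of_forall (fun t => ?_)
      simp [reval]
    · simp [fcoeff_zero]
  smul_mem' := by
    rintro c ⟨f, g⟩ ⟨h, r, hr, he, hg⟩
    refine ⟨c • h, fun i => RatFunc.C c * r i, fun i => (hr i).C_mul c, fun i => ?_,
      fun i n hn => ?_⟩
    · have hf : ∀ᵐ t ∂arc, ∀ j, ((c • f j : Hardy p) : LpT p) t = c * (f j : LpT p) t := by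
        rw [ae_all_iff]
        intro j
        filter_upwards [Lp.coeFn_smul c (f j : LpT p)] with t ht
        simpa using ht
      filter_upwards [he i, hf, Lp.coeFn_smul c (h i), reval_C_mul_ae c (r i)]
        with t h1 h3 h4 h5
      simp only [Prod.smul_mk, Pi.smul_apply, smul_eq_mul] at h1 h4 ⊢
      rw [h4, h5, Finset.sum_congr rfl (fun j _ => by rw [h3 j, mul_left_comm]),
        ← Finset.mul_sum, h1]
      ring
    · have h1 := hg i n hn
      simp only [Prod.smul_mk, Pi.smul_apply, Submodule.coe_smul] at h1 ⊢
      rw [fcoeff_smul, fcoeff_smul, h1]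

/-- The graph is single-valued: `T_Ω f = P h` does not depend on the choice of `h` and `r`. -/
theorem toeplitzGraph_single_valued (p : ℝ≥0∞) [Fact (1 ≤ p)] {m : ℕ}
    (Ω : Matrix (Fin m) (Fin m) (RatFunc ℂ)) (x : HardyVec p m × HardyVec p m)
    (hx : x ∈ toeplitzGraph p Ω) (hx0 : x.1 = 0) : x.2 = 0 := by
  obtain ⟨h, r, hr, he, hg⟩ := hx
  have h0 : ∀ i, h i = 0 := by
    intro i
    have he' : ∀ᵐ t ∂arc, h i t + reval (r i) (pt t) = 0 := by
      filter_upwards [he i, Lp.coeFn_zero ℂ p arc] with t ht h1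
      rw [← ht]
      refine Finset.sum_eq_zero (fun j _ => ?_)
      simp [hx0]
    have hri := (hr i).eq_zero_of_ae (h i) he'
    refine Lp.ext ?_
    filter_upwards [he', Lp.coeFn_zero ℂ p arc] with t ht h1
    rw [h1]
    simpa [hri, reval] using ht
  funext i
  apply Subtype.ext
  apply eq_zero_of_fcoeff
  intro n
  rcases lt_or_ge n 0 with hn | hn
  · exact (x.2 i).2 n hn
  · rw [hg i n hn, h0 i, fcoeff_zero]

/-- The Toeplitz-like operator `T_Ω (H^p_m → H^p_m)` as an unbounded linear operator. -/
def toeplitzOp (p : ℝ≥0∞) [Fact (1 ≤ p)] {m : ℕ} (Ω : Matrix (Fin m) (Fin m) (RatFunc ℂ)) :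
    HardyVec p m →ₗ.[ℂ] HardyVec p m :=
  (toeplitzGraph p Ω).toLinearPMap

/-! ### Block matrix representations and Hankel matrices -/

/-- The semi-infinite block matrix `[t i j]` represents the operator `T` with respect to the
standard block basis of `H^p_m`: all `z ^ j w` lie in the domain of `T`, and the `i`-th Taylor
coefficient of `T (z ^ j w)` is `t i j w`. -/
def HasBlockMatrix {p : ℝ≥0∞} [Fact (1 ≤ p)] {m : ℕ} (T : HardyVec p m →ₗ.[ℂ] HardyVec p m)
    (t : ℕ → ℕ → Matrix (Fin m) (Fin m) ℂ) : Prop :=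
  ∀ (j : ℕ) (w : Fin m → ℂ), ∃ hdom : monomialVec p j w ∈ T.domain,
    ∀ (i : ℕ) (k : Fin m),
      fcoeff (T ⟨monomialVec p j w, hdom⟩ k : LpT p) (i : ℤ) = (t i j *ᵥ w) k

/-- The `k × k` block Hankel matrix with blocks `b (r + s + 1)`, `0 ≤ r, s < k`; its first
block row is `b 1, …, b k`. -/
def blockHankel {m : ℕ} (b : ℕ → Matrix (Fin m) (Fin m) ℂ) (k : ℕ) :
    Matrix (Fin k × Fin m) (Fin k × Fin m) ℂ :=
  Matrix.of fun x y => b ((x.1 : ℕ) + (y.1 : ℕ) + 1) x.2 y.2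

/-- The graph of the operator `T_Ω` is the set of pairs described above. -/
theorem mem_toeplitzGraph_iff (p : ℝ≥0∞) [Fact (1 ≤ p)] {m : ℕ}
    (Ω : Matrix (Fin m) (Fin m) (RatFunc ℂ)) (f g : HardyVec p m) :
    (∃ hf : f ∈ (toeplitzOp p Ω).domain, toeplitzOp p Ω ⟨f, hf⟩ = g) ↔
      (f, g) ∈ toeplitzGraph p Ω := by
  rw [← Submodule.toLinearPMap_graph_eq _ (toeplitzGraph_single_valued p Ω),
    LinearPMap.mem_graph_iff]
  constructor
  · rintro ⟨hf, h⟩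
    exact ⟨⟨f, hf⟩, rfl, h⟩
  · rintro ⟨⟨y, hy⟩, rfl, h⟩
    exact ⟨hy, h⟩

end ToeplitzLike

end

open ToeplitzLike

noncomputable section

namespace ToeplitzLike

/-! ### Polynomials with prescribed roots -/

/-! The problem reduces to scalar entries: by linearity, and because the block matrix of an operator
is unique, a block symbol exists exactly when every entry sequence `b` is an `IsRationalSymbolSeq`
(`exists_hasBlockMatrix_iff`).

From symbol to sequence (`exists_represents`), partial fractions split a rational function as `B/D +
A/P`, with no zero of `D` and every zero of `P` on the circle. The Fourier coefficients of the
continuous function `B/D` become finitely supported under `D(shift)`, so both halves are recurrent;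
they tend to `0`, and a recurrent null sequence is summable. The part `A/P` is expanded at infinity
as `u 0 / z + u 1 / z² + ⋯`. Then `z ^ j A/P` is a polynomial plus an element of `Rat_0(𝕋)`, so
`A/P` contributes only the entries `u` above the diagonal, and these grow polynomially because the
zeros of `P` have modulus one.

Conversely (`IsRationalSymbolSeq.exists_represents`), a recurrent negative half of polynomial growth
has characteristic roots in the closed disc. Bézout splits it into a summable part and a part `w`
with roots on the circle. Removing `w` leaves a summable sequence, which is the Fourier series of a
function that is rational by recurrence; `w` is the expansion of some `A/Q`.

The three conditions translate into this language. Bounded Hankel rank is recurrence, which is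
Kronecker's theorem. The binomial bound is polynomial growth. The `H^p` condition forces the entries
to tend to `0` by Riemann-Lebesgue, hence to be summable once they are recurrent; conversely,
summable norms are the coefficients of an absolutely convergent series.

All growth statements come from `mem_of_aeval_shift_mem`, which strips off one factor `S - λ` at a
time. -/

theorem exists_factorization_of_roots (q : ℂ → Prop) (P : ℂ[X]) (hP : P ≠ 0) :
    ∃ P₁ P₂ : ℂ[X], P = P₁ * P₂ ∧ (∀ z, P₁.IsRoot z → q z) ∧ ∀ z, P₂.IsRoot z → ¬ q z := by
  induction hn : P.natDegree generalizing P with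
  | zero =>
    rw [Polynomial.natDegree_eq_zero] at hn
    obtain ⟨c, rfl⟩ := hn
    have hc : c ≠ 0 := by simpa using hP
    exact ⟨Polynomial.C c, 1, by simp, by simp [hc], by simp⟩
  | succ n ih =>
    obtain ⟨x, hx⟩ := IsAlgClosed.exists_root P (by
      intro h
      rw [Polynomial.natDegree_eq_of_degree_eq_some (n := 0) h] at hn
      omega)
    obtain ⟨Q, rfl⟩ := Polynomial.dvd_iff_isRoot.2 hx
    have hQ : Q ≠ 0 := right_ne_zero_of_mul hP
    have hdeg : Q.natDegree = n := by
      rw [Polynomial.natDegree_mul (Polynomial.X_sub_C_ne_zero x) hQ,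
        Polynomial.natDegree_X_sub_C] at hn
      omega
    obtain ⟨P₁, P₂, rfl, h₁, h₂⟩ := ih Q hQ hdeg
    by_cases hq : q x
    · refine ⟨(Polynomial.X - Polynomial.C x) * P₁, P₂, by ring, fun z hz => ?_, h₂⟩
      rcases Polynomial.root_mul.1 hz with h | h
      · rwa [← Polynomial.root_X_sub_C.1 h]
      · exact h₁ z h
    · refine ⟨P₁, (Polynomial.X - Polynomial.C x) * P₂, by ring, h₁, fun z hz => ?_⟩
      rcases Polynomial.root_mul.1 hz with h | h
      · rwa [← Polynomial.root_X_sub_C.1 h]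
      · exact h₂ z h

theorem isCoprime_of_roots (q : ℂ → Prop) {P Q : ℂ[X]} (hP : ∀ z, P.IsRoot z → q z)
    (hQ : ∀ z, Q.IsRoot z → ¬ q z) : IsCoprime P Q := by
  rw [Polynomial.isCoprime_iff_aeval_ne_zero_of_isAlgClosed ℂ ℂ]
  intro z
  by_contra! h
  exact hQ z (by simpa using h.2) (hP z (by simpa using h.1))

/-! ### Linear recurrences -/

/-- The shift of a sequence. -/
def shift : Module.End ℂ (ℕ → ℂ) := LinearMap.funLeft ℂ ℂ Nat.succ

@[simp] theorem shift_apply (u : ℕ → ℂ) (n : ℕ) : shift u n = u (n + 1) := rfl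

theorem shift_pow_apply (k : ℕ) (u : ℕ → ℂ) (n : ℕ) : (shift ^ k) u n = u (n + k) := by
  induction k generalizing u n with
  | zero => simp
  | succ k ih => rw [pow_succ, Module.End.mul_apply, ih, shift_apply, add_assoc]

/-- The free bound `d` allows a polynomial and its reverse, whose degree may be smaller, to be
expanded over the same range. -/
theorem aeval_shift_apply {d : ℕ} {P : ℂ[X]} (hd : P.natDegree ≤ d) (u : ℕ → ℂ) (n : ℕ) :
    Polynomial.aeval shift P u n
      = ∑ k ∈ Finset.range (d + 1), P.coeff k * u (n + k) := by
  rw [Polynomial.aeval_eq_sum_range' (Nat.lt_succ_of_le hd), LinearMap.sum_apply,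
    Finset.sum_apply]
  simp [shift_pow_apply]

theorem aeval_mul_apply (P Q : ℂ[X]) {V : Type*} [AddCommGroup V] [Module ℂ V]
    (T : Module.End ℂ V) (u : V) : Polynomial.aeval T (P * Q) u
      = Polynomial.aeval T P (Polynomial.aeval T Q u) := by
  rw [map_mul, Module.End.mul_apply]

theorem aeval_shift_mem {G : Submodule ℂ (ℕ → ℂ)} (hG : ∀ u ∈ G, shift u ∈ G) (P : ℂ[X])
    {u : ℕ → ℂ} (hu : u ∈ G) : Polynomial.aeval shift P u ∈ G := by
  have hpow : ∀ k : ℕ, (shift ^ k) u ∈ G := by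
    intro k
    induction k with
    | zero => simpa using hu
    | succ k ih => rw [pow_succ', Module.End.mul_apply]; exact hG _ ih
  rw [Polynomial.aeval_eq_sum_range, LinearMap.sum_apply]
  exact Submodule.sum_mem _ fun k _ => G.smul_mem _ (hpow k)

/-- If a space `H` contains every `u` in the shift-invariant space `G` for which some
`(S - λ) u`, `λ` a root of `P`, is in `H`, then it contains every `u ∈ G` with `P(S) u ∈ H`. -/
theorem mem_of_aeval_shift_mem {G H : Submodule ℂ (ℕ → ℂ)} (hG : ∀ u ∈ G, shift u ∈ G)
    (P : ℂ[X]) (hP : P ≠ 0)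
    (hroot : ∀ z, P.IsRoot z → ∀ u ∈ G, shift u - z • u ∈ H → u ∈ H)
    {u : ℕ → ℂ} (hu : u ∈ G) (hPu : Polynomial.aeval shift P u ∈ H) : u ∈ H := by
  induction hn : P.natDegree generalizing P with
  | zero =>
    rw [Polynomial.natDegree_eq_zero] at hn
    obtain ⟨c, rfl⟩ := hn
    have hc : c ≠ 0 := by simpa using hP
    rw [Polynomial.aeval_C, Module.algebraMap_end_apply] at hPu
    exact (H.smul_mem_iff hc).1 hPu
  | succ n ih =>
    obtain ⟨x, hx⟩ := IsAlgClosed.exists_root P (by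
      intro h
      rw [Polynomial.natDegree_eq_of_degree_eq_some (n := 0) h] at hn
      omega)
    obtain ⟨Q, rfl⟩ := Polynomial.dvd_iff_isRoot.2 hx
    have hQ : Q ≠ 0 := right_ne_zero_of_mul hP
    have hdeg : Q.natDegree = n := by
      rw [Polynomial.natDegree_mul (Polynomial.X_sub_C_ne_zero x) hQ,
        Polynomial.natDegree_X_sub_C] at hn
      omega
    refine ih Q hQ (fun z hz => hroot z (Polynomial.root_mul.2 (Or.inr hz))) ?_ hdeg
    -- Here `(S - x) Q(S) u ∈ H`. Invariance of `G` keeps `Q(S) u` in `G`, so the factor `S - x` can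
    -- be removed.
    refine hroot x hx _ (aeval_shift_mem hG Q hu) ?_
    rw [aeval_mul_apply] at hPu
    simpa using hPu

/-- A sequence that satisfies a linear recurrence with constant coefficients. -/
def IsRecurrent (u : ℕ → ℂ) : Prop := ∃ P : ℂ[X], P ≠ 0 ∧ Polynomial.aeval shift P u = 0

theorem IsRecurrent.add {u v : ℕ → ℂ} (hu : IsRecurrent u) (hv : IsRecurrent v) :
    IsRecurrent (u + v) := by
  obtain ⟨P, hP, hPu⟩ := hu
  obtain ⟨Q, hQ, hQv⟩ := hv
  refine ⟨P * Q, mul_ne_zero hP hQ, ?_⟩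
  rw [map_add, aeval_mul_apply P Q shift v, hQv, mul_comm, aeval_mul_apply, hPu]
  simp

/-- Finitely many initial terms do not matter: an extra factor `X ^ k` in the annihilator skips
them. -/
theorem isRecurrent_of_shift_pow (k : ℕ) {u : ℕ → ℂ} (hu : IsRecurrent ((shift ^ k) u)) :
    IsRecurrent u := by
  obtain ⟨P, hP, hPu⟩ := hu
  refine ⟨P * Polynomial.X ^ k, mul_ne_zero hP (pow_ne_zero _ Polynomial.X_ne_zero), ?_⟩
  rwa [aeval_mul_apply, map_pow, Polynomial.aeval_X]

/-! ### Growth of recurrent sequences -/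

/-- The sequences that tend to `0`. -/
def nullSeq : Submodule ℂ (ℕ → ℂ) where
  carrier := {u | Tendsto u atTop (𝓝 0)}
  add_mem' := fun {u v} hu hv => by simpa using! Tendsto.add hu hv
  zero_mem' := tendsto_const_nhds
  smul_mem' := fun c u hu => by simpa using! Tendsto.const_smul hu c

/-- The summable sequences. -/
def summableSeq : Submodule ℂ (ℕ → ℂ) where
  carrier := {u | Summable u}
  add_mem' := fun hu hv => Summable.add hu hv
  zero_mem' := summable_zero
  smul_mem' := fun c _ hu => Summable.const_smul c hu

/-- The sequences of at most polynomial growth. -/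
def polyGrowth : Submodule ℂ (ℕ → ℂ) where
  carrier := {u | ∃ (M : ℕ) (C : ℝ), ∀ n, ‖u n‖ ≤ C * ((n : ℝ) + 1) ^ M}
  add_mem' := by
    rintro u v ⟨M, C, hu⟩ ⟨M', C', hv⟩
    refine ⟨M + M', |C| + |C'|, fun n => (norm_add_le _ _).trans ?_⟩
    have h1 : (1 : ℝ) ≤ (n : ℝ) + 1 := by linarith [Nat.cast_nonneg (α := ℝ) n]
    rw [add_mul]
    refine add_le_add ((hu n).trans ?_) ((hv n).trans ?_)
    · exact mul_le_mul (le_abs_self C) (pow_le_pow_right₀ h1 (by omega)) (by positivity)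
        (abs_nonneg C)
    · exact mul_le_mul (le_abs_self C') (pow_le_pow_right₀ h1 (by omega)) (by positivity)
        (abs_nonneg C')
  zero_mem' := ⟨0, 0, fun n => by simp⟩
  smul_mem' := by
    rintro c u ⟨M, C, hu⟩
    refine ⟨M, ‖c‖ * C, fun n => ?_⟩
    rw [Pi.smul_apply, norm_smul, mul_assoc]
    exact mul_le_mul_of_nonneg_left (hu n) (norm_nonneg c)

theorem shift_mem_nullSeq {u : ℕ → ℂ} (hu : u ∈ nullSeq) : shift u ∈ nullSeq :=
  (tendsto_add_atTop_iff_nat (f := u) 1).2 hu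

theorem shift_mem_polyGrowth {u : ℕ → ℂ} (hu : u ∈ polyGrowth) : shift u ∈ polyGrowth := by
  obtain ⟨M, C, hu⟩ := hu
  refine ⟨M, |C| * 2 ^ M, fun n => (hu (n + 1)).trans ?_⟩
  rw [mul_assoc, ← mul_pow]
  refine mul_le_mul (le_abs_self C) (pow_le_pow_left₀ (by positivity) ?_ M) (by positivity)
    (abs_nonneg C)
  push_cast
  linarith [Nat.cast_nonneg (α := ℝ) n]

theorem eq_pow_smul_of_shift_eq {u : ℕ → ℂ} {z : ℂ} (h : shift u = z • u) (n : ℕ) :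
    u n = z ^ n * u 0 := by
  induction n with
  | zero => simp
  | succ n ih =>
    have := congrFun h n
    rw [shift_apply, Pi.smul_apply, smul_eq_mul] at this
    rw [this, ih]
    ring

theorem eq_zero_of_shift_eq_of_mem_nullSeq {u : ℕ → ℂ} (hu : u ∈ nullSeq) {z : ℂ}
    (hz : 1 ≤ ‖z‖) (h : shift u = z • u) : u = 0 := by
  have h1 : Tendsto (fun n => ‖u n‖) atTop (𝓝 0) := by simpa using Tendsto.norm hu
  have h2 : ‖u 0‖ ≤ 0 := by
    refine ge_of_tendsto' h1 fun n => ?_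
    rw [eq_pow_smul_of_shift_eq h n, norm_mul, norm_pow]
    exact le_mul_of_one_le_left (norm_nonneg _) (one_le_pow₀ hz)
  have h3 : u 0 = 0 := norm_le_zero_iff.1 h2
  funext n
  rw [eq_pow_smul_of_shift_eq h n, h3, mul_zero, Pi.zero_apply]

/-- The sequence is `z ^ n * u 0`, and exponential growth beats every polynomial unless `u 0 = 0`.
-/
theorem eq_zero_of_shift_eq_of_mem_polyGrowth {u : ℕ → ℂ} (hu : u ∈ polyGrowth) {z : ℂ}
    (hz : 1 < ‖z‖) (h : shift u = z • u) : u = 0 := by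
  obtain ⟨M, C, hu⟩ := hu
  have h1 : Tendsto (fun n : ℕ => C * (‖z‖ * (((n + 1 : ℕ) : ℝ) ^ M / ‖z‖ ^ (n + 1)))) atTop
      (𝓝 (C * (‖z‖ * 0))) :=
    (((tendsto_pow_const_div_const_pow_of_one_lt M hz).comp
      (tendsto_add_atTop_nat 1)).const_mul _).const_mul _
  have h2 : ‖u 0‖ ≤ 0 := by
    rw [mul_zero, mul_zero] at h1
    refine ge_of_tendsto' h1 fun n => ?_
    have h3 := hu n
    have hz0 : 0 < ‖z‖ := by linarith
    rw [eq_pow_smul_of_shift_eq h n, norm_mul, norm_pow, mul_comm, ← le_div_iff₀ (by positivity)]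
      at h3
    refine h3.trans (le_of_eq ?_)
    push_cast
    field_simp
    ring
  have h3 : u 0 = 0 := norm_le_zero_iff.1 h2
  funext n
  rw [eq_pow_smul_of_shift_eq h n, h3, mul_zero, Pi.zero_apply]

/-- Summing `‖u (n + 1)‖ ≤ ‖z‖ ‖u n‖ + ‖(S u - z u) n‖` bounds the partial sums of `‖u n‖` by `‖z‖`
times themselves plus a constant, and `‖z‖ < 1` allows the sums to be absorbed. -/
theorem mem_summableSeq_of_shift_sub {u : ℕ → ℂ} {z : ℂ} (hz : ‖z‖ < 1)
    (h : shift u - z • u ∈ summableSeq) : u ∈ summableSeq := by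
  have h1 : Summable fun n => ‖(shift u - z • u) n‖ := Summable.norm h
  set W := ∑' n, ‖(shift u - z • u) n‖
  have hstep : ∀ n, ‖u (n + 1)‖ ≤ ‖z‖ * ‖u n‖ + ‖(shift u - z • u) n‖ := by
    intro n
    have h2 : u (n + 1) = z * u n + (shift u - z • u) n := by simp
    calc ‖u (n + 1)‖ = ‖z * u n + (shift u - z • u) n‖ := by rw [← h2]
      _ ≤ _ := (norm_add_le _ _).trans (by rw [norm_mul])
  refine Summable.of_norm (summable_of_sum_range_le (c := (‖u 0‖ + W) / (1 - ‖z‖))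
    (fun n => norm_nonneg _) fun n => ?_)
  rw [le_div_iff₀ (by linarith)]
  have h3 : ∑ k ∈ Finset.range n, ‖u k‖ ≤ ∑ k ∈ Finset.range (n + 1), ‖u k‖ := by
    rw [Finset.sum_range_succ]
    linarith [norm_nonneg (u n)]
  have h4 : ∑ k ∈ Finset.range (n + 1), ‖u k‖
      ≤ ‖z‖ * ∑ k ∈ Finset.range n, ‖u k‖ + W + ‖u 0‖ := by
    rw [Finset.sum_range_succ', Finset.mul_sum]
    have h5 : ∑ k ∈ Finset.range n, ‖(shift u - z • u) k‖ ≤ W :=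
      h1.sum_le_tsum _ fun _ _ => norm_nonneg _
    have h6 := Finset.sum_le_sum fun k (_ : k ∈ Finset.range n) => hstep k
    rw [Finset.sum_add_distrib] at h6
    linarith
  linarith

/-- Each step adds at most `|C| (n + 1) ^ M`, so accumulating the steps raises the exponent by one.
-/
theorem mem_polyGrowth_of_shift_sub {u : ℕ → ℂ} {z : ℂ} (hz : ‖z‖ ≤ 1)
    (h : shift u - z • u ∈ polyGrowth) : u ∈ polyGrowth := by
  obtain ⟨M, C, hC⟩ := h
  have hstep : ∀ n, ‖u (n + 1)‖ ≤ ‖u n‖ + |C| * ((n : ℝ) + 1) ^ M := by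
    intro n
    have h2 : u (n + 1) = z * u n + (shift u - z • u) n := by simp
    rw [h2]
    refine (norm_add_le _ _).trans (add_le_add ?_ ((hC n).trans ?_))
    · rw [norm_mul]
      exact mul_le_of_le_one_left (norm_nonneg _) hz
    · exact mul_le_mul_of_nonneg_right (le_abs_self C) (by positivity)
  refine ⟨M + 1, ‖u 0‖ + |C|, fun n => ?_⟩
  induction n with
  | zero => simp
  | succ n ih =>
    refine (hstep n).trans ?_
    have h1 : ((n : ℝ) + 1) ^ M ≤ ((n : ℝ) + 2) ^ M :=
      pow_le_pow_left₀ (by positivity) (by linarith) M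
    have h2 : (‖u 0‖ + |C|) * ((n : ℝ) + 1) ^ (M + 1)
        ≤ (‖u 0‖ + |C|) * (((n : ℝ) + 2) ^ M * ((n : ℝ) + 1)) := by
      rw [pow_succ]
      gcongr
    have h3 : |C| * ((n : ℝ) + 1) ^ M ≤ (‖u 0‖ + |C|) * ((n : ℝ) + 2) ^ M := by
      refine mul_le_mul ?_ h1 (by positivity) (by positivity)
      linarith [norm_nonneg (u 0)]
    push_cast
    have h4 : ((n : ℝ) + 1 + 1) ^ (M + 1)
        = ((n : ℝ) + 2) ^ M * ((n : ℝ) + 1) + ((n : ℝ) + 2) ^ M := by ring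
    rw [h4, mul_add]
    linarith

theorem summable_of_aeval_shift_eq_zero {P : ℂ[X]} (hP : P ≠ 0)
    (hroot : ∀ z, P.IsRoot z → ‖z‖ < 1) {u : ℕ → ℂ} (hu : Polynomial.aeval shift P u = 0) :
    Summable u :=
  mem_of_aeval_shift_mem (G := ⊤) (H := summableSeq) (fun _ _ => Submodule.mem_top) P hP
    (fun z hz _ _ h => mem_summableSeq_of_shift_sub (hroot z hz) h) Submodule.mem_top
    (by rw [hu]; exact zero_mem _)

theorem mem_polyGrowth_of_aeval_shift_eq_zero {P : ℂ[X]} (hP : P ≠ 0)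
    (hroot : ∀ z, P.IsRoot z → ‖z‖ ≤ 1) {u : ℕ → ℂ} (hu : Polynomial.aeval shift P u = 0) :
    u ∈ polyGrowth :=
  mem_of_aeval_shift_mem (G := ⊤) (H := polyGrowth) (fun _ _ => Submodule.mem_top) P hP
    (fun z hz _ _ h => mem_polyGrowth_of_shift_sub (hroot z hz) h) Submodule.mem_top
    (by rw [hu]; exact zero_mem _)

/-- A recurrent null sequence is annihilated by a polynomial with roots in the open disc, and
therefore summable. -/
theorem IsRecurrent.summable {u : ℕ → ℂ} (hu : IsRecurrent u)
    (h0 : Tendsto u atTop (𝓝 0)) : Summable u := by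
  obtain ⟨P, hP, hPu⟩ := hu
  obtain ⟨P₁, P₂, rfl, h₁, h₂⟩ := exists_factorization_of_roots (fun z => ‖z‖ < 1) P hP
  refine summable_of_aeval_shift_eq_zero (left_ne_zero_of_mul hP) h₁ ?_
  rw [mul_comm, aeval_mul_apply] at hPu
  -- With `H = ⊥` the peeling lemma says that `P₂(S)` is injective on null sequences: a geometric
  -- sequence with ratio of modulus at least `1` is null only if it is zero.
  refine (Submodule.mem_bot ℂ).1 (mem_of_aeval_shift_mem (G := nullSeq) (H := ⊥)
    (fun _ => shift_mem_nullSeq) P₂ (right_ne_zero_of_mul hP) (fun z hz v hv h => ?_)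
    (aeval_shift_mem (fun _ => shift_mem_nullSeq) P₁ h0) ((Submodule.mem_bot ℂ).2 hPu))
  rw [Submodule.mem_bot] at h ⊢
  exact eq_zero_of_shift_eq_of_mem_nullSeq hv (not_lt.1 (h₂ z hz)) (sub_eq_zero.1 h)

/-- A recurrent sequence of polynomial growth is the sum of one annihilated by a polynomial with
roots in the open disc and one annihilated by a polynomial with roots on the circle. -/
theorem IsRecurrent.exists_decomposition {u : ℕ → ℂ} (hu : IsRecurrent u)
    (h0 : u ∈ polyGrowth) : ∃ (v w : ℕ → ℂ) (P Q : ℂ[X]), u = v + w ∧ P ≠ 0 ∧ Q ≠ 0 ∧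
      (∀ z, P.IsRoot z → ‖z‖ < 1) ∧ (∀ z, Q.IsRoot z → ‖z‖ = 1) ∧
      Polynomial.aeval shift P v = 0 ∧ Polynomial.aeval shift Q w = 0 := by
  obtain ⟨P, hP, hPu⟩ := hu
  obtain ⟨P₁, P₂, rfl, h₁, h₂⟩ := exists_factorization_of_roots (fun z => ‖z‖ ≤ 1) P hP
  have hP₁u : Polynomial.aeval shift P₁ u = 0 := by
    rw [mul_comm, aeval_mul_apply] at hPu
    refine (Submodule.mem_bot ℂ).1 (mem_of_aeval_shift_mem (G := polyGrowth) (H := ⊥)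
      (fun _ => shift_mem_polyGrowth) P₂ (right_ne_zero_of_mul hP) (fun z hz v hv h => ?_)
      (aeval_shift_mem (fun _ => shift_mem_polyGrowth) P₁ h0) ((Submodule.mem_bot ℂ).2 hPu))
    rw [Submodule.mem_bot] at h ⊢
    exact eq_zero_of_shift_eq_of_mem_polyGrowth hv (not_le.1 (h₂ z hz)) (sub_eq_zero.1 h)
  have hP₁ : P₁ ≠ 0 := left_ne_zero_of_mul hP
  obtain ⟨A, B, rfl, hA, hB⟩ := exists_factorization_of_roots (fun z => ‖z‖ < 1) P₁ hP₁
  -- From `x A + y B = 1`, the component `y B` of `u` is killed by `A` and the component `x A` by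
  -- `B`, since `A B` kills `u`.
  obtain ⟨x, y, hxy⟩ := isCoprime_of_roots _ hA hB
  refine ⟨Polynomial.aeval shift (y * B) u, Polynomial.aeval shift (x * A) u, A, B, ?_,
    left_ne_zero_of_mul hP₁, right_ne_zero_of_mul hP₁, hA, fun z hz => le_antisymm
      (h₁ z (Polynomial.root_mul.2 (Or.inr hz))) (not_lt.1 (hB z hz)), ?_, ?_⟩
  · rw [← LinearMap.add_apply, ← map_add, add_comm, hxy, map_one, Module.End.one_apply]
  · rw [← aeval_mul_apply, show A * (y * B) = y * (A * B) by ring, aeval_mul_apply, hP₁u, map_zero]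
  · rw [← aeval_mul_apply, show B * (x * A) = x * (A * B) by ring, aeval_mul_apply, hP₁u, map_zero]

/-! ### Kronecker's theorem -/

/-- For each `k`, a dependency among `N + 1` columns gives a nonzero polynomial of degree at most
`N` whose recurrence holds at the first `k` places. These solution spaces `V k` decrease inside a
finite-dimensional space, so they stabilize, and a nonzero element of the stable space works at all
places. -/
theorem isRecurrent_of_rank_hankel_le {u : ℕ → ℂ} {N : ℕ}
    (h : ∀ k : ℕ, (Matrix.of fun r s : Fin k => u (r + s)).rank ≤ N) : IsRecurrent u := by
  let V : ℕ → Submodule ℂ (Polynomial.degreeLT ℂ (N + 1)) := fun k =>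
    { carrier := {P | ∀ r < k, Polynomial.aeval shift (P : ℂ[X]) u r = 0}
      add_mem' := fun {P Q} hP hQ r hr => by
        simp only [Submodule.coe_add, map_add, LinearMap.add_apply, Pi.add_apply, hP r hr,
          hQ r hr, add_zero]
      zero_mem' := fun r _ => by simp
      smul_mem' := fun c P hP r hr => by
        simp only [Submodule.coe_smul, map_smul, LinearMap.smul_apply, Pi.smul_apply, hP r hr,
          smul_zero] }
  have hV : Antitone V := fun k l hkl P hP r hr => hP r (hr.trans_le hkl)
  have hne : ∀ k, V k ≠ ⊥ := by
    intro k
    -- The Hankel matrix must have at least `k` rows, to control the first `k` places, and at least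
    -- `N + 1` columns.
    obtain ⟨K, hkK, hNK⟩ : ∃ K, k ≤ K ∧ N + 1 ≤ K :=
      ⟨max k (N + 1), le_max_left _ _, le_max_right _ _⟩
    have hdep : ¬ LinearIndependent ℂ (fun s : Fin (N + 1) => fun r : Fin K => u (r + s)) := by
      intro hli
      have h1 := h K
      have h2 := LinearIndependent.fintype_card_le_finrank (R := ℂ)
        (M := Submodule.span ℂ (Set.range (Matrix.of fun r s : Fin K => u (r + s)).col))
        (b := fun s : Fin (N + 1) => ⟨fun r : Fin K => u (r + s),
          Submodule.subset_span ⟨Fin.castLE hNK s, by ext; simp [Matrix.col]⟩⟩)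
        (LinearIndependent.of_comp (Submodule.subtype _) hli)
      rw [← Matrix.rank_eq_finrank_span_cols, Fintype.card_fin] at h2
      omega
    obtain ⟨g, hg, i, hi⟩ := Fintype.not_linearIndependent_iff.1 hdep
    let P : ℂ[X] := ∑ s : Fin (N + 1), Polynomial.monomial (s : ℕ) (g s)
    have hPmem : P ∈ Polynomial.degreeLT ℂ (N + 1) := by
      refine Submodule.sum_mem _ fun s _ => Polynomial.mem_degreeLT.2 ?_
      exact (Polynomial.degree_monomial_le _ _).trans_lt (by exact_mod_cast s.2)
    have hcoeff : P.coeff i = g i := by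
      simp [P, Polynomial.coeff_monomial, Fin.val_inj]
    intro hbot
    have hmem : (⟨P, hPmem⟩ : Polynomial.degreeLT ℂ (N + 1)) ∈ V k := by
      intro r hr
      have h3 := congrFun hg ⟨r, hr.trans_le hkK⟩
      simp only [Finset.sum_apply, Pi.smul_apply, smul_eq_mul, Pi.zero_apply] at h3
      simp only [P, map_sum, LinearMap.sum_apply, Finset.sum_apply, Polynomial.aeval_monomial]
      rw [← h3]
      refine Finset.sum_congr rfl fun s _ => ?_
      rw [Module.End.mul_apply, Module.algebraMap_end_apply, Pi.smul_apply, shift_pow_apply,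
        smul_eq_mul]
    rw [hbot, Submodule.mem_bot] at hmem
    have h4 : P = 0 := congrArg Subtype.val hmem
    rw [h4, Polynomial.coeff_zero] at hcoeff
    exact hi hcoeff.symm
  obtain ⟨n, hn⟩ := IsArtinian.monotone_stabilizes (⟨fun k => OrderDual.toDual (V k), hV⟩ :
    ℕ →o (Submodule ℂ (Polynomial.degreeLT ℂ (N + 1)))ᵒᵈ)
  obtain ⟨P, hP, hP0⟩ := Submodule.exists_mem_ne_zero_of_ne_bot (hne n)
  refine ⟨P, fun h0 => hP0 (Subtype.ext h0), funext fun r => ?_⟩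
  have h5 : P ∈ V (max n (r + 1)) := by
    have h6 : V n = V (max n (r + 1)) := hn _ (le_max_left _ _)
    rwa [← h6]
  exact h5 r (by omega)

/-- Scalar blocks of a Hankel matrix of bounded rank are recurrent. -/
theorem isRecurrent_of_rank_blockHankel_le {m : ℕ} {b : ℕ → Matrix (Fin m) (Fin m) ℂ} {N : ℕ}
    (h : ∀ k : ℕ, 1 ≤ k → (blockHankel b k).rank ≤ N) (i c : Fin m) :
    IsRecurrent (fun n => b (n + 1) i c) := by
  refine isRecurrent_of_rank_hankel_le (N := N) fun k => ?_
  rcases Nat.eq_zero_or_pos k with rfl | hk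
  · exact (Matrix.rank_le_card_width _).trans (by simp)
  · refine le_trans ?_ (h k hk)
    exact Matrix.rank_submatrix_le (blockHankel b k) (fun r : Fin k => (r, i)) (fun s => (s, c))

/-- Conversely, a Hankel matrix with recurrent entries has bounded rank. -/
theorem exists_rank_blockHankel_le {m : ℕ} {b : ℕ → Matrix (Fin m) (Fin m) ℂ}
    (h : ∀ i c, IsRecurrent (fun n => b (n + 1) i c)) :
    ∃ N : ℕ, ∀ k : ℕ, (blockHankel b k).rank ≤ N := by
  choose P hP hPb using h
  let Q : ℂ[X] := ∏ i, ∏ c, P i c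
  have hQ : Q ≠ 0 :=
    Finset.prod_ne_zero_iff.2 fun i _ => Finset.prod_ne_zero_iff.2 fun c _ => hP i c
  have hQb : ∀ i c, Polynomial.aeval shift Q (fun n => b (n + 1) i c) = 0 := by
    intro i c
    obtain ⟨R, hR⟩ : P i c ∣ Q := (Finset.dvd_prod_of_mem (P i) (Finset.mem_univ c)).trans
      (Finset.dvd_prod_of_mem (fun i => ∏ c, P i c) (Finset.mem_univ i))
    rw [hR, mul_comm, aeval_mul_apply, hPb, map_zero]
  set d := Q.natDegree
  -- Reducing `X ^ r` modulo the common annihilator writes block row `r` through the first `d + 1`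
  -- block rows, with scalar coefficients independent of the entry and the column. Using `d + 1`
  -- rather than `d` also covers constant `Q`.
  have key : ∀ (r n : ℕ) (i c : Fin m), b (r + n + 1) i c
      = ∑ t : Fin (d + 1), (Polynomial.X ^ r % Q).coeff t * b (t + n + 1) i c := by
    intro r n i c
    have h1 : Polynomial.aeval shift (Polynomial.X ^ r : ℂ[X]) (fun n => b (n + 1) i c) n
        = Polynomial.aeval shift (Polynomial.X ^ r % Q) (fun n => b (n + 1) i c) n := by
      conv_lhs => rw [← EuclideanDomain.div_add_mod (Polynomial.X ^ r : ℂ[X]) Q, map_add,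
        LinearMap.add_apply, mul_comm, aeval_mul_apply, hQb, map_zero, zero_add]
    rw [map_pow, Polynomial.aeval_X, shift_pow_apply] at h1
    have h2 : (Polynomial.X ^ r % Q).natDegree < d + 1 := by
      refine Nat.lt_succ_of_le (Polynomial.natDegree_le_natDegree ?_)
      exact (EuclideanDomain.mod_lt _ hQ).le
    rw [Polynomial.aeval_eq_sum_range' h2, LinearMap.sum_apply, Finset.sum_apply,
      Finset.sum_range] at h1
    rw [add_comm r n, h1]
    refine Finset.sum_congr rfl fun t _ => ?_
    rw [LinearMap.smul_apply, Pi.smul_apply, shift_pow_apply, smul_eq_mul, add_comm n]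
  refine ⟨Fintype.card (Fin (d + 1) × Fin m), fun k => ?_⟩
  have hfac : blockHankel b k
      = (Matrix.of fun (x : Fin k × Fin m) (y : Fin (d + 1) × Fin m) =>
          if x.2 = y.2 then (Polynomial.X ^ (x.1 : ℕ) % Q).coeff y.1 else 0)
        * (Matrix.of fun (x : Fin (d + 1) × Fin m) (y : Fin k × Fin m) =>
          b ((x.1 : ℕ) + (y.1 : ℕ) + 1) x.2 y.2) := by
    ext x y
    rw [Matrix.mul_apply, Fintype.sum_prod_type]
    simp only [Matrix.of_apply, ite_mul, zero_mul, Finset.sum_ite_eq, Finset.mem_univ, if_true]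
    exact key _ _ _ _
  rw [hfac]
  exact (Matrix.rank_mul_le_left _ _).trans (Matrix.rank_le_card_width _)

/-! ### Two-sided sequences -/

/-- The shift of two-sided sequences to the right. -/
def backShift : Module.End ℂ (ℤ → ℂ) := LinearMap.funLeft ℂ ℂ (fun n => n - 1)

@[simp] theorem backShift_apply (c : ℤ → ℂ) (n : ℤ) : backShift c n = c (n - 1) := rfl

theorem backShift_pow_apply (k : ℕ) (c : ℤ → ℂ) (n : ℤ) : (backShift ^ k) c n = c (n - k) := by
  induction k generalizing c n with
  | zero => simp
  | succ k ih =>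
    rw [pow_succ, Module.End.mul_apply, ih, backShift_apply]
    push_cast
    ring_nf

theorem aeval_backShift_apply {d : ℕ} {P : ℂ[X]} (hd : P.natDegree ≤ d) (c : ℤ → ℂ) (n : ℤ) :
    Polynomial.aeval backShift P c n
      = ∑ k ∈ Finset.range (d + 1), P.coeff k * c (n - k) := by
  rw [Polynomial.aeval_eq_sum_range' (Nat.lt_succ_of_le hd), LinearMap.sum_apply,
    Finset.sum_apply]
  simp [backShift_pow_apply]

theorem coeff_reverse_of_le (P : ℂ[X]) {k : ℕ} (hk : k ≤ P.natDegree) :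
    P.reverse.coeff k = P.coeff (P.natDegree - k) := by
  rw [Polynomial.coeff_reverse, Polynomial.revAt_le hk]

/-- The back shift reads the recurrence window `n + 1, …, n + 1 + deg P` from right to left, which
reverses the coefficients. The companion identity below is not a substitution instance of this one,
because reversing twice loses factors of `X`. -/
theorem aeval_backShift_reverse_eq (P : ℂ[X]) (c : ℤ → ℂ) (n : ℕ) :
    Polynomial.aeval backShift P.reverse c (n + 1 + P.natDegree : ℕ)
      = Polynomial.aeval shift P (fun k => c ((k : ℤ) + 1)) n := by
  rw [aeval_backShift_apply (Polynomial.reverse_natDegree_le P), aeval_shift_apply le_rfl,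
    ← Finset.sum_range_reflect]
  refine Finset.sum_congr rfl fun k hk => ?_
  have hk' : k ≤ P.natDegree := by simpa [Nat.lt_succ_iff] using hk
  rw [coeff_reverse_of_le P (by omega)]
  exact congrArg₂ (· * ·) (congrArg P.coeff (by omega)) (congrArg c (by push_cast; omega))

theorem aeval_shift_reverse_eq (P : ℂ[X]) (c : ℤ → ℂ) (n : ℕ) :
    Polynomial.aeval shift P.reverse (fun k => c ((k : ℤ) + 1)) n
      = Polynomial.aeval backShift P c (n + 1 + P.natDegree : ℕ) := by
  rw [aeval_backShift_apply le_rfl, aeval_shift_apply (Polynomial.reverse_natDegree_le P),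
    ← Finset.sum_range_reflect]
  refine Finset.sum_congr rfl fun k hk => ?_
  have hk' : k ≤ P.natDegree := by simpa [Nat.lt_succ_iff] using hk
  rw [coeff_reverse_of_le P (by omega)]
  exact congrArg₂ (· * ·) (congrArg P.coeff (by omega)) (congrArg c (by push_cast; omega))

theorem aeval_shift_neg_eq (P : ℂ[X]) (c : ℤ → ℂ) (n : ℕ) :
    Polynomial.aeval shift P (fun k => c (-((k : ℤ) + 1))) n
      = Polynomial.aeval backShift P c (-((n : ℤ) + 1)) := by
  rw [aeval_backShift_apply le_rfl, aeval_shift_apply le_rfl]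
  refine Finset.sum_congr rfl fun k _ => ?_
  push_cast
  ring_nf

/-- The coefficients of a polynomial as a two-sided sequence. -/
def intCoeff (P : ℂ[X]) (n : ℤ) : ℂ := if 0 ≤ n then P.coeff n.toNat else 0

@[simp] theorem intCoeff_natCast (P : ℂ[X]) (n : ℕ) : intCoeff P n = P.coeff n := by
  simp [intCoeff]

theorem intCoeff_of_neg (P : ℂ[X]) {n : ℤ} (hn : n < 0) : intCoeff P n = 0 :=
  if_neg (not_le.2 hn)

/-- The right-hand side vanishes at negative indices and beyond `deg B`. On the positive side the
recurrence therefore holds after dropping `deg B` terms. -/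
theorem isRecurrent_of_aeval_backShift {D B : ℂ[X]} (hD : D ≠ 0) {c : ℤ → ℂ}
    (h : Polynomial.aeval backShift D c = intCoeff B) :
    IsRecurrent (fun n => c ((n : ℤ) + 1)) ∧ IsRecurrent (fun n => c (-((n : ℤ) + 1))) := by
  constructor
  · refine isRecurrent_of_shift_pow B.natDegree ⟨D.reverse, by simpa using hD, ?_⟩
    have hcomm : shift ^ B.natDegree
        = Polynomial.aeval shift (Polynomial.X ^ B.natDegree : ℂ[X]) := by
      rw [map_pow, Polynomial.aeval_X]
    rw [hcomm, ← aeval_mul_apply, mul_comm, aeval_mul_apply, ← hcomm]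
    funext n
    rw [shift_pow_apply, aeval_shift_reverse_eq, h, intCoeff_natCast, Pi.zero_apply]
    exact Polynomial.coeff_eq_zero_of_natDegree_lt (by omega)
  · refine ⟨D, hD, funext fun n => ?_⟩
    rw [aeval_shift_neg_eq, h, intCoeff_of_neg _ (by omega), Pi.zero_apply]

/-- A two-sided sequence both halves of which are recurrent is mapped to a finitely supported
one by some polynomial in the shift. -/
theorem exists_aeval_backShift_eq {c : ℤ → ℂ} (h₁ : IsRecurrent (fun n => c ((n : ℤ) + 1)))
    (h₂ : IsRecurrent (fun n => c (-((n : ℤ) + 1)))) :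
    ∃ D B : ℂ[X], D ≠ 0 ∧ Polynomial.aeval backShift D c = intCoeff B := by
  obtain ⟨P, hP, hPc⟩ := h₁
  obtain ⟨Q, hQ, hQc⟩ := h₂
  have hpos : ∀ n : ℤ, (P.natDegree : ℤ) < n → Polynomial.aeval backShift P.reverse c n = 0 := by
    intro n hn
    obtain ⟨k, hk⟩ := Int.eq_ofNat_of_zero_le (show 0 ≤ n - 1 - P.natDegree by omega)
    rw [show n = ((k + 1 + P.natDegree : ℕ) : ℤ) by push_cast; omega,
      aeval_backShift_reverse_eq, hPc, Pi.zero_apply]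
  have hneg : ∀ n : ℤ, n < 0 → Polynomial.aeval backShift Q c n = 0 := by
    intro n hn
    obtain ⟨k, hk⟩ := Int.eq_ofNat_of_zero_le (show 0 ≤ -n - 1 by omega)
    rw [show n = -((k : ℤ) + 1) by omega, ← aeval_shift_neg_eq, hQc, Pi.zero_apply]
  -- The reversed `P` clears the indices above `deg P`, and `Q` clears the negative ones. Applying
  -- the other factor afterwards only spreads the support to the right, by a bounded amount.
  set e : ℤ → ℂ := Polynomial.aeval backShift (P.reverse * Q) c with he
  have hepos : ∀ n : ℤ, (P.natDegree : ℤ) + Q.natDegree < n → e n = 0 := by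
    intro n hn
    rw [he, mul_comm, aeval_mul_apply, aeval_backShift_apply le_rfl]
    refine Finset.sum_eq_zero fun k hk => ?_
    rw [Finset.mem_range] at hk
    rw [hpos _ (by omega), mul_zero]
  have heneg : ∀ n : ℤ, n < 0 → e n = 0 := by
    intro n hn
    rw [he, aeval_mul_apply, aeval_backShift_apply le_rfl]
    refine Finset.sum_eq_zero fun k hk => ?_
    rw [hneg _ (by omega), mul_zero]
  refine ⟨P.reverse * Q, ∑ k ∈ Finset.range (P.natDegree + Q.natDegree + 1),
    Polynomial.monomial k (e k), mul_ne_zero (by simpa using hP) hQ, funext fun n => ?_⟩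
  rcases lt_or_ge n 0 with hn | hn
  · rw [intCoeff_of_neg _ hn]
    exact heneg n hn
  · obtain ⟨k, rfl⟩ := Int.eq_ofNat_of_zero_le hn
    rw [intCoeff_natCast, Polynomial.finsetSum_coeff]
    simp only [Polynomial.coeff_monomial, Finset.sum_ite_eq', Finset.mem_range]
    split_ifs with hk
    · rfl
    · exact hepos _ (by omega)

/-! ### Fourier coefficients -/

theorem fourier_eq_pt_pow (n : ℕ) (t : UnitAddCircle) : fourier (n : ℤ) t = pt t ^ n := by
  rw [fourier_apply, pt, natCast_zsmul, AddCircle.toCircle_nsmul, Circle.coe_pow]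

theorem continuous_pt : Continuous pt :=
  continuous_subtype_val.comp AddCircle.continuous_toCircle

theorem norm_pt (t : UnitAddCircle) : ‖pt t‖ = 1 := Circle.norm_coe _

theorem integrable_eval_mul (D : ℂ[X]) {f : UnitAddCircle → ℂ} (hf : Integrable f arc) :
    Integrable (fun t => D.eval (pt t) * f t) arc := by
  let φ : C(UnitAddCircle, ℂ) := ⟨fun t => D.eval (pt t), D.continuous.comp continuous_pt⟩
  exact hf.bdd_mul (c := ‖φ‖) φ.continuous.aestronglyMeasurable
    (Eventually.of_forall φ.norm_coe_le_norm)

theorem fourierCoeff_eval_mul (D : ℂ[X]) {f : UnitAddCircle → ℂ} (hf : Integrable f arc) :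
    fourierCoeff (fun t => D.eval (pt t) * f t)
      = Polynomial.aeval backShift D (fourierCoeff f) := by
  induction D using Polynomial.induction_on' with
  | add P Q hP hQ =>
    rw [map_add, LinearMap.add_apply, ← hP, ← hQ,
      ← fourierCoeff.add (integrable_eval_mul P hf) (integrable_eval_mul Q hf)]
    congr 1
    funext t
    simp [add_mul]
  | monomial k a =>
    funext n
    rw [Polynomial.aeval_monomial, Module.End.mul_apply, Module.algebraMap_end_apply,
      Pi.smul_apply, backShift_pow_apply, smul_eq_mul, ← fourierCoeff.const_mul]
    refine integral_congr_ae (Eventually.of_forall fun t => ?_)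
    simp only [Polynomial.eval_monomial, smul_eq_mul]
    rw [← fourier_eq_pt_pow, show -(n - (k : ℤ)) = -n + k by ring, fourier_add]
    ring

theorem fourierCoeff_eval (D : ℂ[X]) :
    fourierCoeff (fun t => D.eval (pt t)) = intCoeff D := by
  have h1 : Integrable (fun _ : UnitAddCircle => (1 : ℂ)) arc := integrable_const 1
  have h2 : fourierCoeff (fun _ : UnitAddCircle => (1 : ℂ)) = Pi.single 0 1 := by
    rw [← fourierCoeff_fourier (T := 1) 0]
    congr 1
    funext t
    rw [fourier_zero]
  have h3 := fourierCoeff_eval_mul D h1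
  simp only [mul_one] at h3
  rw [h3, h2]
  funext n
  rw [aeval_backShift_apply le_rfl]
  simp only [Pi.single_apply, mul_ite, mul_one, mul_zero]
  rcases lt_or_ge n 0 with hn | hn
  · rw [intCoeff_of_neg _ hn]
    exact Finset.sum_eq_zero fun k _ => if_neg (by omega)
  · obtain ⟨k, rfl⟩ := Int.eq_ofNat_of_zero_le hn
    rw [intCoeff_natCast]
    simp only [sub_eq_zero, Nat.cast_inj, Finset.sum_ite_eq, Finset.mem_range, ite_eq_left_iff]
    intro hk
    exact (Polynomial.coeff_eq_zero_of_natDegree_lt (by omega)).symm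

theorem ae_eq_zero_of_fourierCoeff {f : UnitAddCircle → ℂ} (hf : Integrable f arc)
    (h : ∀ n, fourierCoeff f n = 0) : ∀ᵐ t ∂arc, f t = 0 := by
  have h1 : hf.toL1 f = 0 := by
    refine eq_zero_of_fcoeff (p := 1) _ fun n => ?_
    rw [fcoeff, fourierCoeff_congr_ae hf.coeFn_toL1, h]
  filter_upwards [hf.coeFn_toL1, Lp.coeFn_zero ℂ 1 arc] with t h2 h3
  rw [← h2, h1, h3, Pi.zero_apply]

section

variable {p : ℝ≥0∞} [Fact (1 ≤ p)]

theorem integrable_coe (f : LpT p) : Integrable f arc := (Lp.memLp f).integrable Fact.out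

theorem norm_fcoeff_le (f : LpT p) (n : ℤ) : ‖fcoeff f n‖ ≤ ‖f‖ := by
  have h1 : ‖fcoeff f n‖ ≤ ∫ t, ‖f t‖ ∂arc := by
    refine norm_integral_le_of_norm_le (integrable_coe f).norm (Eventually.of_forall fun t => ?_)
    rw [norm_smul, fourier_apply, Circle.norm_coe, one_mul]
  refine h1.trans ?_
  rw [integral_norm_eq_lintegral_enorm (Lp.aestronglyMeasurable f),
    ← eLpNorm_one_eq_lintegral_enorm, Lp.norm_def]
  exact ENNReal.toReal_mono (Lp.eLpNorm_ne_top f)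
    (eLpNorm_le_eLpNorm_of_exponent_le Fact.out (Lp.aestronglyMeasurable f))

/-- A Fourier coefficient as a continuous functional on `L^p`. -/
def fcoeffCLM (n : ℤ) : LpT p →L[ℂ] ℂ :=
  LinearMap.mkContinuous
    { toFun := fun f => fcoeff f n
      map_add' := fun f g => fcoeff_add f g n
      map_smul' := fun c f => fcoeff_smul c f n } 1
    (fun f => by rw [one_mul]; exact norm_fcoeff_le f n)

@[simp] theorem fcoeffCLM_apply (n : ℤ) (f : LpT p) : fcoeffCLM n f = fcoeff f n := rfl

theorem fcoeff_fourierLp (k n : ℤ) :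
    fcoeff (fourierLp p k : LpT p) n = if n = k then 1 else 0 := by
  rw [fcoeff, fourierCoeff_congr_ae (coeFn_fourierLp p k), fourierCoeff_fourier, Pi.single_apply]

/-- The Riemann-Lebesgue lemma. -/
theorem tendsto_fcoeff (hp : p ≠ ∞) (f : LpT p) : Tendsto (fcoeff f) cofinite (𝓝 0) := by
  -- Trigonometric polynomials have finitely many nonzero coefficients and are dense for finite `p`;
  -- coefficients are contractive in the `L^p` norm.
  have hspan : ∀ g ∈ Submodule.span ℂ (Set.range (fourierLp p : ℤ → LpT p)),
      ∀ᶠ n in cofinite, fcoeff g n = 0 := by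
    intro g hg
    induction hg using Submodule.span_induction with
    | mem g hg =>
      obtain ⟨k, rfl⟩ := hg
      filter_upwards [(Set.finite_singleton k).compl_mem_cofinite] with n hn
      rw [fcoeff_fourierLp]
      exact if_neg hn
    | zero => exact Eventually.of_forall fcoeff_zero
    | add g g' _ _ h h' =>
      filter_upwards [h, h'] with n hn hn'
      rw [fcoeff_add, hn, hn', add_zero]
    | smul c g _ h =>
      filter_upwards [h] with n hn
      rw [fcoeff_smul, hn, mul_zero]
  rw [Metric.tendsto_nhds]
  intro ε hε
  have hf : f ∈ closure (Submodule.span ℂ (Set.range (fourierLp p : ℤ → LpT p)) :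
      Set (LpT p)) := by
    rw [← Submodule.topologicalClosure_coe, span_fourierLp_closure_eq_top hp]
    exact Submodule.mem_top
  obtain ⟨g, hg, hfg⟩ := Metric.mem_closure_iff.1 hf ε hε
  filter_upwards [hspan g hg] with n hn
  have h1 := norm_fcoeff_le (f - g) n
  rw [← fcoeffCLM_apply, map_sub, fcoeffCLM_apply, fcoeffCLM_apply, hn, sub_zero] at h1
  rw [dist_zero_right]
  exact h1.trans_lt (by rwa [← dist_eq_norm])

/-- The Fourier series converges absolutely in the continuous functions, and the embedding into
`L^p` and the coefficient functionals are continuous. -/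
theorem exists_fcoeff_eq (p : ℝ≥0∞) [Fact (1 ≤ p)] {c : ℤ → ℂ} (hc : Summable c) :
    ∃ f : LpT p, ∀ n, fcoeff f n = c n := by
  have h1 : Summable fun k => c k • (fourier k : C(UnitAddCircle, ℂ)) := by
    refine Summable.of_norm ?_
    simp only [norm_smul, fourier_norm, mul_one]
    exact hc.norm
  have h2 := (ContinuousMap.toLp (E := ℂ) p arc ℂ).hasSum h1.hasSum
  refine ⟨ContinuousMap.toLp (E := ℂ) p arc ℂ (∑' k, c k • fourier k), fun n => ?_⟩
  have h3 := (fcoeffCLM n).hasSum h2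
  refine h3.unique ?_
  convert hasSum_ite_eq n (c n) using 2 with k
  rw [map_smul, map_smul, fcoeffCLM_apply, fcoeff_fourierLp, smul_eq_mul]
  by_cases hk : n = k
  · simp [hk]
  · simp [hk, Ne.symm hk]

theorem exists_hardy_fcoeff_eq (p : ℝ≥0∞) [Fact (1 ≤ p)] {c : ℕ → ℂ} (hc : Summable c) :
    ∃ f : Hardy p, ∀ n : ℕ, fcoeff (f : LpT p) n = c n := by
  let c' : ℤ → ℂ := fun n => if 0 ≤ n then c n.toNat else 0
  have hneg : ∀ n : ℤ, n < 0 → c' n = 0 := fun n hn => if_neg (not_le.2 hn)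
  have hc' : Summable c' := by
    refine Summable.of_nat_of_neg_add_one (by simpa [c'] using hc) ?_
    refine summable_zero.congr fun n => (hneg _ (by omega)).symm
  obtain ⟨f, hf⟩ := exists_fcoeff_eq p hc'
  exact ⟨⟨f, fun n hn => (hf n).trans (hneg n hn)⟩, fun n => (hf n).trans (by simp [c'])⟩

theorem exists_eval_mul_fcoeff (D : ℂ[X]) (f : LpT p) :
    ∃ g : LpT p, (∀ᵐ t ∂arc, g t = D.eval (pt t) * f t) ∧
      fcoeff g = Polynomial.aeval backShift D (fcoeff f) := by
  let φ : C(UnitAddCircle, ℂ) := ⟨fun t => D.eval (pt t), D.continuous.comp continuous_pt⟩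
  have h : MemLp (fun t => D.eval (pt t) * f t) p arc :=
    (Lp.memLp f).of_le_mul (c := ‖φ‖)
      (φ.continuous.aestronglyMeasurable.mul (Lp.aestronglyMeasurable f))
      (Eventually.of_forall fun t => by
        rw [norm_mul]
        exact mul_le_mul_of_nonneg_right (φ.norm_coe_le_norm t) (norm_nonneg _))
  refine ⟨h.toLp _, h.coeFn_toLp, funext fun n => ?_⟩
  rw [fcoeff, fourierCoeff_congr_ae h.coeFn_toLp, fourierCoeff_eval_mul D (integrable_coe f)]
  rfl

theorem exists_continuous_fcoeff (p : ℝ≥0∞) [Fact (1 ≤ p)] {φ : UnitAddCircle → ℂ}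
    (hφ : Continuous φ) : ∃ g : LpT p, (∀ᵐ t ∂arc, g t = φ t) ∧ fcoeff g = fourierCoeff φ := by
  have h := ContinuousMap.coeFn_toLp (E := ℂ) (p := p) (𝕜 := ℂ) arc ⟨φ, hφ⟩
  exact ⟨_, h, funext fun n => by rw [fcoeff, fourierCoeff_congr_ae h]; rfl⟩

end

/-! ### Values of rational functions -/

theorem reval_zero (z : ℂ) : reval 0 z = 0 := RatFunc.eval_zero _ _

theorem reval_mul_ae (r s : RatFunc ℂ) :
    ∀ᵐ t ∂arc, reval (r * s) (pt t) = reval r (pt t) * reval s (pt t) := by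
  filter_upwards [ae_denom_ne_zero _ r.denom_ne_zero, ae_denom_ne_zero _ s.denom_ne_zero]
    with t h1 h2
  exact RatFunc.eval_mul _ _ h1 h2

theorem reval_sum_ae {ι : Type*} (s : Finset ι) (r : ι → RatFunc ℂ) :
    ∀ᵐ t ∂arc, reval (∑ i ∈ s, r i) (pt t) = ∑ i ∈ s, reval (r i) (pt t) := by
  classical
  induction s using Finset.induction_on with
  | empty => exact Eventually.of_forall fun t => by simp [reval_zero]
  | insert i s hi ih =>
    filter_upwards [ih, reval_add_ae (r i) (∑ i ∈ s, r i)] with t h1 h2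
    rw [Finset.sum_insert hi, Finset.sum_insert hi, h2, h1]

theorem reval_algebraMap (P : ℂ[X]) (z : ℂ) :
    reval (algebraMap ℂ[X] (RatFunc ℂ) P) z = P.eval z := by
  rw [reval, RatFunc.eval_algebraMap]
  rfl

theorem reval_div_ae (N : ℂ[X]) {D : ℂ[X]} (hD : D ≠ 0) :
    ∀ᵐ t ∂arc, D.eval (pt t) ≠ 0 ∧
      reval (algebraMap ℂ[X] (RatFunc ℂ) N / algebraMap ℂ[X] (RatFunc ℂ) D) (pt t)
        = N.eval (pt t) / D.eval (pt t) := by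
  have hD' : algebraMap ℂ[X] (RatFunc ℂ) D ≠ 0 := RatFunc.algebraMap_ne_zero hD
  filter_upwards [ae_denom_ne_zero D hD,
    -- Evaluation is defined in lowest terms while `N / D` may not be reduced, so the value is found
    -- by multiplying by `D` and cancelling.
    reval_mul_ae (algebraMap ℂ[X] (RatFunc ℂ) N / algebraMap ℂ[X] (RatFunc ℂ) D)
      (algebraMap ℂ[X] (RatFunc ℂ) D)] with t h1 h2
  have h1' : D.eval (pt t) ≠ 0 := h1
  refine ⟨h1', ?_⟩
  rw [div_mul_cancel₀ _ hD', reval_algebraMap, reval_algebraMap] at h2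
  rw [h2, mul_div_cancel_right₀ _ h1']

theorem isRatZeroCircle_div {N D : ℂ[X]} (hD : D ≠ 0) (hdeg : N.degree < D.degree)
    (hroot : ∀ z, D.IsRoot z → ‖z‖ = 1) :
    IsRatZeroCircle (algebraMap ℂ[X] (RatFunc ℂ) N / algebraMap ℂ[X] (RatFunc ℂ) D) := by
  refine ⟨degree_num_lt _ hD ((RatFunc.num_mul_eq_mul_denom_iff hD).2 rfl) hdeg, fun z hz =>
    hroot z (hz.dvd (RatFunc.denom_div_dvd N D))⟩

theorem IsRatZeroCircle.sum {ι : Type*} (s : Finset ι) {r : ι → RatFunc ℂ}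
    (h : ∀ i ∈ s, IsRatZeroCircle (r i)) : IsRatZeroCircle (∑ i ∈ s, r i) :=
  Finset.sum_induction _ IsRatZeroCircle (fun _ _ => IsRatZeroCircle.add) IsRatZeroCircle.zero h

/-- An integrable function is rational if both halves of its Fourier coefficients are
recurrent. -/
theorem exists_reval_ae_eq {f : UnitAddCircle → ℂ} (hf : Integrable f arc)
    (h₁ : IsRecurrent (fun n => fourierCoeff f ((n : ℤ) + 1)))
    (h₂ : IsRecurrent (fun n => fourierCoeff f (-((n : ℤ) + 1)))) :
    ∃ r : RatFunc ℂ, ∀ᵐ t ∂arc, reval r (pt t) = f t := by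
  obtain ⟨D, B, hD, hDB⟩ := exists_aeval_backShift_eq h₁ h₂
  refine ⟨algebraMap ℂ[X] (RatFunc ℂ) B / algebraMap ℂ[X] (RatFunc ℂ) D, ?_⟩
  have hi : Integrable (fun t => B.eval (pt t)) arc := by
    simpa using integrable_eval_mul B (integrable_const (1 : ℂ))
  have h0 : ∀ᵐ t ∂arc, D.eval (pt t) * f t - B.eval (pt t) = 0 := by
    refine ae_eq_zero_of_fourierCoeff ((integrable_eval_mul D hf).sub hi) fun n => ?_
    have h3 := congrFun (fourierCoeff.add (integrable_eval_mul D hf) (hi.const_mul (-1))) n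
    rw [Pi.add_apply, fourierCoeff.const_mul, fourierCoeff_eval, fourierCoeff_eval_mul D hf,
      hDB, neg_one_mul, add_neg_cancel] at h3
    rw [← h3]
    congr 1
    funext t
    simp [sub_eq_add_neg]
  filter_upwards [h0, reval_div_ae B hD] with t h4 h5
  rw [h5.2, div_eq_iff h5.1, mul_comm]
  exact (sub_eq_zero.1 h4).symm

/-! ### Expansion of strictly proper rational functions at infinity -/

/-- The polynomial part of `z ^ j (u 0 z⁻¹ + u 1 z⁻² + ⋯)`. -/
def polyPart : ℕ → (ℕ → ℂ) →ₗ[ℂ] ℂ[X]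
  | 0 => 0
  | j + 1 => LinearMap.mulLeft ℂ Polynomial.X ∘ₗ polyPart j
      + Polynomial.monomial 0 ∘ₗ LinearMap.proj j

@[simp] theorem polyPart_zero (u : ℕ → ℂ) : polyPart 0 u = 0 := rfl

theorem polyPart_succ (j : ℕ) (u : ℕ → ℂ) :
    polyPart (j + 1) u = Polynomial.X * polyPart j u + Polynomial.C (u j) := rfl

theorem coeff_polyPart (j : ℕ) (u : ℕ → ℂ) (i : ℕ) :
    (polyPart j u).coeff i = if i < j then u (j - 1 - i) else 0 := by
  induction j generalizing i with
  | zero => simp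
  | succ j ih =>
    rw [polyPart_succ, Polynomial.coeff_add]
    cases i with
    | zero => simp
    | succ i =>
      rw [Polynomial.coeff_X_mul, ih, Polynomial.coeff_C_succ, add_zero]
      simp only [Nat.add_lt_add_iff_right]
      congr 2
      omega

theorem degree_polyPart_lt (j : ℕ) (u : ℕ → ℂ) : (polyPart j u).degree < j := by
  rw [Polynomial.degree_lt_iff_coeff_zero]
  intro i hi
  rw [coeff_polyPart, if_neg (by omega)]

/-- Splitting the first `j + k` terms at `j`, or symmetrically at `k`, gives two expressions for one
polynomial; their comparison yields the remainder in `exists_numerator`. -/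
theorem polyPart_add (u : ℕ → ℂ) (j k : ℕ) :
    polyPart (j + k) u = Polynomial.X ^ k * polyPart j u + polyPart k ((shift ^ j) u) := by
  induction k with
  | zero => simp
  | succ k ih =>
    rw [← add_assoc, polyPart_succ, ih, polyPart_succ, shift_pow_apply, add_comm k j]
    ring

/-- A sequence annihilated by `P(S)` is the expansion at infinity of a strictly proper rational
function with denominator `P`. -/
theorem exists_numerator {P : ℂ[X]} (hP : P ≠ 0) {u : ℕ → ℂ}
    (hu : Polynomial.aeval shift P u = 0) :
    ∃ A : ℂ[X], ∀ j, (Polynomial.X ^ j * A - P * polyPart j u).degree < P.degree := by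
  -- This is the polynomial part of `P` times the series of `u`. The remainder after `j` steps turns
  -- out to be the same expression for the shifted sequence.
  refine ⟨∑ k ∈ Finset.range (P.natDegree + 1), P.coeff k • polyPart k u, fun j => ?_⟩
  have h1 : ∑ k ∈ Finset.range (P.natDegree + 1), P.coeff k • polyPart j ((shift ^ k) u) = 0 := by
    rw [← (polyPart j).map_zero, ← hu, Polynomial.aeval_eq_sum_range, LinearMap.sum_apply, map_sum]
    exact Finset.sum_congr rfl fun k _ => by rw [LinearMap.smul_apply, map_smul]
  have h2 : Polynomial.X ^ j * ∑ k ∈ Finset.range (P.natDegree + 1), P.coeff k • polyPart k u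
      - P * polyPart j u
      = ∑ k ∈ Finset.range (P.natDegree + 1), P.coeff k • polyPart k ((shift ^ j) u) := by
    have h4 : P * polyPart j u = ∑ k ∈ Finset.range (P.natDegree + 1),
        Polynomial.C (P.coeff k) * Polynomial.X ^ k * polyPart j u := by
      rw [← Finset.sum_mul, ← P.as_sum_range_C_mul_X_pow]
    rw [← sub_zero (∑ k ∈ Finset.range (P.natDegree + 1), P.coeff k • polyPart k ((shift ^ j) u)),
      ← h1, h4, Finset.mul_sum, ← Finset.sum_sub_distrib, ← Finset.sum_sub_distrib]
    refine Finset.sum_congr rfl fun k _ => ?_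
    have h3 := polyPart_add u j k
    rw [add_comm, polyPart_add u k j] at h3
    simp only [Polynomial.smul_eq_C_mul]
    linear_combination Polynomial.C (P.coeff k) * h3
  rw [h2]
  refine (Polynomial.degree_sum_le _ _).trans_lt ?_
  rw [Finset.sup_lt_iff (bot_lt_iff_ne_bot.2 (by simpa using hP))]
  intro k hk
  refine (Polynomial.degree_smul_le _ _).trans_lt ((degree_polyPart_lt _ _).trans_le ?_)
  rw [Polynomial.degree_eq_natDegree hP]
  exact_mod_cast Nat.lt_succ_iff.1 (Finset.mem_range.1 hk)

theorem exists_degree_X_mul_sub_lt {P B : ℂ[X]} (hB : B.degree < P.degree) :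
    ∃ c : ℂ, (Polynomial.X * B - Polynomial.C c * P).degree < P.degree := by
  have hP : P ≠ 0 := by
    rintro rfl
    simp at hB
  refine ⟨(Polynomial.X * B).coeff P.natDegree / P.leadingCoeff, ?_⟩
  rw [Polynomial.degree_eq_natDegree hP, Polynomial.degree_lt_iff_coeff_zero] at hB ⊢
  intro k hk
  rw [Polynomial.coeff_sub, Polynomial.coeff_C_mul]
  rcases hk.eq_or_lt with rfl | hk
  · rw [Polynomial.coeff_natDegree, div_mul_cancel₀ _ (by simpa using hP), sub_self]
  · obtain ⟨k, rfl⟩ : ∃ l, k = l + 1 := ⟨k - 1, by omega⟩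
    rw [Polynomial.coeff_X_mul, hB k (by omega), Polynomial.coeff_eq_zero_of_natDegree_lt hk]
    simp

/-- The expansion at infinity of a strictly proper rational function. -/
theorem exists_expansion {P A : ℂ[X]} (hA : A.degree < P.degree) :
    ∃ u : ℕ → ℂ, Polynomial.aeval shift P u = 0 ∧
      ∀ j, (Polynomial.X ^ j * A - P * polyPart j u).degree < P.degree := by
  have hP : P ≠ 0 := by
    rintro rfl
    simp at hA
  choose! c hc using fun (B : ℂ[X]) (hB : B.degree < P.degree) => exists_degree_X_mul_sub_lt hB
  -- Long division: each remainder is multiplied by `X` and reduced by a multiple of `P`, and the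
  -- successive quotients are the coefficients `u j`.
  let R : ℕ → ℂ[X] := fun j =>
    Nat.rec A (fun _ B => Polynomial.X * B - Polynomial.C (c B) * P) j
  have hR : ∀ j, (R j).degree < P.degree := by
    intro j
    induction j with
    | zero => exact hA
    | succ j ih => exact hc _ ih
  let u : ℕ → ℂ := fun j => c (R j)
  have hu : ∀ j, Polynomial.X ^ j * A - P * polyPart j u = R j := by
    intro j
    induction j with
    | zero => simp [R]
    | succ j ih =>
      have h1 : R (j + 1) = Polynomial.X * R j - Polynomial.C (u j) * P := rfl
      rw [h1, ← ih, polyPart_succ]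
      ring
  refine ⟨u, funext fun n => ?_, fun j => (hu j).symm ▸ hR j⟩
  -- `P * B` has degree below `deg P`, so `B = 0`. Since `X ^ (n + 1) * A` has no constant term, the
  -- constant coefficient of `B` is minus the recurrence at place `n`.
  set B := Polynomial.X ^ (n + 1) * A
    - ∑ k ∈ Finset.range (P.natDegree + 1), P.coeff k • polyPart (n + 1 + k) u with hB
  have h2 : P * B = ∑ k ∈ Finset.range (P.natDegree + 1), P.coeff k • R (n + 1 + k) := by
    rw [hB, mul_sub]
    nth_rewrite 1 [P.as_sum_range_C_mul_X_pow]
    rw [Finset.mul_sum, Finset.sum_mul, ← Finset.sum_sub_distrib]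
    refine Finset.sum_congr rfl fun k _ => ?_
    simp only [Polynomial.smul_eq_C_mul]
    rw [← hu (n + 1 + k)]
    ring
  have h3 : (P * B).degree < P.degree := by
    rw [h2]
    refine (Polynomial.degree_sum_le _ _).trans_lt ?_
    rw [Finset.sup_lt_iff (bot_lt_iff_ne_bot.2 (by simpa using hP))]
    exact fun k _ => (Polynomial.degree_smul_le _ _).trans_lt (hR _)
  have h4 : B = 0 := by
    by_contra h
    exact absurd h3 (not_lt.2 (Polynomial.degree_le_mul_left P h))
  have h5 := congrArg (Polynomial.coeff · 0) h4
  simp only [hB, Polynomial.coeff_sub, Polynomial.finsetSum_coeff, Polynomial.coeff_smul,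
    coeff_polyPart, smul_eq_mul, Polynomial.coeff_zero] at h5
  rw [pow_succ', mul_assoc, Polynomial.mul_coeff_zero, Polynomial.coeff_X_zero, zero_mul,
    zero_sub, neg_eq_zero] at h5
  rw [aeval_shift_apply le_rfl, Pi.zero_apply, ← h5]
  refine Finset.sum_congr rfl fun k _ => ?_
  rw [if_pos (by omega), show n + 1 + k - 1 - 0 = n + k by omega]

/-! ### Symbols of scalar Toeplitz matrices -/

/-- The two-sided sequence `n ↦ 0`, `-(n + 1) ↦ u n`. -/
def negPart (u : ℕ → ℂ) : ℤ → ℂ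
  | .ofNat _ => 0
  | .negSucc n => u n

@[simp] theorem negPart_natCast (u : ℕ → ℂ) (n : ℕ) : negPart u n = 0 := rfl

theorem negPart_neg (u : ℕ → ℂ) (n : ℕ) : negPart u (-((n : ℤ) + 1)) = u n := by
  rw [← Int.negSucc_eq]
  rfl

/-- The scalar rational function `r` is a symbol of the Toeplitz matrix `[b (i - j)]`. -/
def Represents (p : ℝ≥0∞) [Fact (1 ≤ p)] (r : RatFunc ℂ) (b : ℤ → ℂ) : Prop :=
  ∀ j : ℕ, ∃ (h : LpT p) (s : RatFunc ℂ), IsRatZeroCircle s ∧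
    (∀ᵐ t ∂arc, reval r (pt t) * fourier (j : ℤ) t = h t + reval s (pt t)) ∧
    ∀ i : ℕ, fcoeff h i = b ((i : ℤ) - j)

section

variable {p : ℝ≥0∞} [Fact (1 ≤ p)]

theorem Represents.add {r s : RatFunc ℂ} {b c : ℤ → ℂ} (hr : Represents p r b)
    (hs : Represents p s c) : Represents p (r + s) (b + c) := by
  intro j
  obtain ⟨h, x, hx, he, hf⟩ := hr j
  obtain ⟨h', x', hx', he', hf'⟩ := hs j
  refine ⟨h + h', x + x', hx.add hx', ?_, fun i => ?_⟩
  · filter_upwards [he, he', Lp.coeFn_add h h', reval_add_ae r s, reval_add_ae x x']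
      with t h1 h2 h3 h4 h5
    rw [h3, h4, h5, Pi.add_apply, add_mul, h1, h2]
    ring
  · rw [fcoeff_add, hf, hf', Pi.add_apply]

theorem represents_of_ae_eq {r : RatFunc ℂ} (f : LpT p)
    (hf : ∀ᵐ t ∂arc, reval r (pt t) = f t) : Represents p r (fcoeff f) := by
  intro j
  obtain ⟨h, hh, hc⟩ := exists_eval_mul_fcoeff (Polynomial.X ^ j) f
  refine ⟨h, 0, IsRatZeroCircle.zero, ?_, fun i => ?_⟩
  · filter_upwards [hf, hh] with t h1 h2
    rw [h1, h2, reval_zero, add_zero, fourier_eq_pt_pow, Polynomial.eval_pow, Polynomial.eval_X,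
      mul_comm]
  · rw [hc, map_pow, Polynomial.aeval_X, backShift_pow_apply]

/-- Dividing `z ^ j A` by `P` leaves the polynomial `polyPart j u` as the `L^p` part and a remainder
in `Rat_0(𝕋)`. Column `j` thus reads `u (j - 1), …, u 0, 0, 0, …`. -/
theorem represents_negPart {P A : ℂ[X]} {u : ℕ → ℂ} (hroot : ∀ z, P.IsRoot z → ‖z‖ = 1)
    (h : ∀ j, (Polynomial.X ^ j * A - P * polyPart j u).degree < P.degree) :
    Represents p (algebraMap ℂ[X] (RatFunc ℂ) A / algebraMap ℂ[X] (RatFunc ℂ) P) (negPart u) := by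
  have hP : P ≠ 0 := by
    rintro rfl
    simpa using h 0
  intro j
  obtain ⟨g, hg, hgc⟩ := exists_continuous_fcoeff p
    ((polyPart j u).continuous.comp continuous_pt)
  refine ⟨g, _, isRatZeroCircle_div hP (h j) hroot, ?_, fun i => ?_⟩
  · filter_upwards [hg, reval_div_ae A hP,
      reval_div_ae (Polynomial.X ^ j * A - P * polyPart j u) hP] with t h1 h2 h3
    rw [h1, h2.2, h3.2, fourier_eq_pt_pow]
    have h4 := h2.1
    simp only [Function.comp_apply, Polynomial.eval_sub, Polynomial.eval_mul, Polynomial.eval_pow,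
      Polynomial.eval_X]
    field_simp
    ring
  · rw [hgc, show ((fun z => (polyPart j u).eval z) ∘ pt) = fun t => (polyPart j u).eval (pt t)
      from rfl, fourierCoeff_eval, intCoeff_natCast, coeff_polyPart]
    split_ifs with hij
    · obtain ⟨k, rfl⟩ : ∃ k, j = i + 1 + k := ⟨j - (i + 1), by omega⟩
      rw [show (i : ℤ) - ((i + 1 + k : ℕ) : ℤ) = -((k : ℤ) + 1) by push_cast; ring, negPart_neg]
      congr 1
      omega
    · obtain ⟨k, rfl⟩ : ∃ k, i = j + k := ⟨i - j, by omega⟩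
      rw [show ((j + k : ℕ) : ℤ) - (j : ℤ) = (k : ℤ) by push_cast; ring, negPart_natCast]

/-- The two-sided sequences that come from a rational symbol. -/
structure IsRationalSymbolSeq (b : ℤ → ℂ) : Prop where
  summable : Summable fun n : ℕ => b n
  recurrent_pos : IsRecurrent fun n => b ((n : ℤ) + 1)
  recurrent_neg : IsRecurrent fun n => b (-((n : ℤ) + 1))
  polyGrowth_neg : (fun n : ℕ => b (-((n : ℤ) + 1))) ∈ polyGrowth

theorem IsRecurrent.of_eq_zero : IsRecurrent (0 : ℕ → ℂ) :=
  ⟨1, one_ne_zero, map_zero _⟩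

theorem IsRationalSymbolSeq.add {b c : ℤ → ℂ} (hb : IsRationalSymbolSeq b)
    (hc : IsRationalSymbolSeq c) : IsRationalSymbolSeq (b + c) :=
  ⟨hb.1.add hc.1, hb.2.add hc.2, hb.3.add hc.3, add_mem hb.4 hc.4⟩

theorem isRationalSymbolSeq_negPart {P : ℂ[X]} (hP : P ≠ 0) (hroot : ∀ z, P.IsRoot z → ‖z‖ = 1)
    {u : ℕ → ℂ} (hu : Polynomial.aeval shift P u = 0) : IsRationalSymbolSeq (negPart u) := by
  have h1 : (fun n : ℕ => negPart u (-((n : ℤ) + 1))) = u := funext fun n => negPart_neg u n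
  refine ⟨summable_zero, IsRecurrent.of_eq_zero, ?_, ?_⟩
  · rw [h1]
    exact ⟨P, hP, hu⟩
  · rw [h1]
    exact mem_polyGrowth_of_aeval_shift_eq_zero hP (fun z hz => (hroot z hz).le) hu

theorem isRecurrent_summable_of_nat {c : ℕ → ℂ} (h : IsRecurrent fun n => c (n + 1))
    (h0 : Tendsto c atTop (𝓝 0)) : Summable c :=
  (summable_nat_add_iff 1).1 (h.summable ((tendsto_add_atTop_iff_nat 1).2 h0))

/-- A rational function without poles on the circle. -/
theorem isRationalSymbolSeq_fcoeff (hp : p ≠ ∞) {B D : ℂ[X]} (hD : D ≠ 0) {f : LpT p}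
    (hf : ∀ᵐ t ∂arc, D.eval (pt t) * f t = B.eval (pt t)) : IsRationalSymbolSeq (fcoeff f) := by
  have h1 : Polynomial.aeval backShift D (fcoeff f) = intCoeff B := by
    rw [← fourierCoeff_eval, ← fourierCoeff_congr_ae hf, fourierCoeff_eval_mul D (integrable_coe f)]
    rfl
  obtain ⟨h2, h3⟩ := isRecurrent_of_aeval_backShift hD h1
  refine ⟨isRecurrent_summable_of_nat (by exact_mod_cast h2) ?_, h2, h3, 0, ‖f‖, fun n => ?_⟩
  · have h4 := (tendsto_fcoeff hp f).comp (Nat.cast_injective (R := ℤ)).tendsto_cofinite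
    rwa [Nat.cofinite_eq_atTop] at h4
  · simpa using norm_fcoeff_le f _

/-- Every scalar rational function is the symbol of a Toeplitz matrix. -/
theorem exists_represents (hp : p ≠ ∞) (r : RatFunc ℂ) :
    ∃ b : ℤ → ℂ, Represents p r b ∧ IsRationalSymbolSeq b := by
  obtain ⟨P, D, hPD, hP, hD⟩ := exists_factorization_of_roots (fun z => ‖z‖ = 1) r.denom
    r.denom_ne_zero
  have hP0 : P ≠ 0 := left_ne_zero_of_mul (hPD ▸ r.denom_ne_zero)
  have hD0 : D ≠ 0 := right_ne_zero_of_mul (hPD ▸ r.denom_ne_zero)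
  obtain ⟨x, y, hxy⟩ := isCoprime_of_roots _ hP hD
  -- With `x P + y D = 1`, the numerator over `P` is reduced modulo `P` to be strictly proper; the
  -- quotient moves into the part without poles on the circle.
  set A := r.num * y % P
  set B := r.num * y / P * D + r.num * x
  have hr : r = algebraMap ℂ[X] (RatFunc ℂ) B / algebraMap ℂ[X] (RatFunc ℂ) D
      + algebraMap ℂ[X] (RatFunc ℂ) A / algebraMap ℂ[X] (RatFunc ℂ) P := by
    have h1 : B * P + D * A = r.num := by
      have h2 := EuclideanDomain.div_add_mod (r.num * y) P
      linear_combination D * h2 + r.num * hxy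
    rw [div_add_div _ _ (RatFunc.algebraMap_ne_zero hD0) (RatFunc.algebraMap_ne_zero hP0),
      ← map_mul, ← map_mul, ← map_mul, ← map_add, h1, mul_comm D P, ← hPD, RatFunc.num_div_denom]
  have hDne : ∀ t, D.eval (pt t) ≠ 0 := fun t h => hD _ h (norm_pt t)
  obtain ⟨f, hf, -⟩ := exists_continuous_fcoeff p (φ := fun t => B.eval (pt t) / D.eval (pt t))
    ((B.continuous.comp continuous_pt).div (D.continuous.comp continuous_pt) hDne)
  obtain ⟨u, hu, hA⟩ := exists_expansion (Polynomial.degree_mod_lt (r.num * y) hP0)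
  refine ⟨fcoeff f + negPart u, ?_, ?_⟩
  · rw [hr]
    refine (represents_of_ae_eq f ?_).add (represents_negPart hP hA)
    filter_upwards [hf, reval_div_ae B hD0] with t h1 h2
    rw [h1, h2.2]
  · refine (isRationalSymbolSeq_fcoeff hp hD0 (B := B) ?_).add
      (isRationalSymbolSeq_negPart hP0 hP hu)
    filter_upwards [hf] with t h1
    rw [h1, mul_div_cancel₀ _ (hDne t)]

/-- Conversely, every such sequence has a rational symbol. -/
theorem IsRationalSymbolSeq.exists_represents {b : ℤ → ℂ} (hb : IsRationalSymbolSeq b) :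
    ∃ r : RatFunc ℂ, Represents p r b := by
  obtain ⟨v, w, P, Q, hvw, hP, hQ, hPr, hQr, hPv, hQw⟩ :=
    hb.recurrent_neg.exists_decomposition hb.polyGrowth_neg
  set c : ℤ → ℂ := b - negPart w with hc
  have hcpos : ∀ n : ℕ, c n = b n := fun n => by simp [hc]
  have hcneg : (fun n : ℕ => c (-((n : ℤ) + 1))) = v := by
    funext n
    have h1 := congrFun hvw n
    rw [hc, Pi.sub_apply, negPart_neg, h1, Pi.add_apply, add_sub_cancel_right]
  have hsum : Summable c := by
    refine Summable.of_nat_of_neg_add_one ?_ ?_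
    · simpa only [hcpos] using hb.summable
    · rw [hcneg]
      exact summable_of_aeval_shift_eq_zero hP hPr hPv
  obtain ⟨f, hf⟩ := exists_fcoeff_eq p hsum
  have hf' : fourierCoeff (f : UnitAddCircle → ℂ) = c := funext hf
  obtain ⟨r, hr⟩ := exists_reval_ae_eq (integrable_coe f)
    (by
      rw [hf']
      convert hb.recurrent_pos using 2 with n
      exact_mod_cast hcpos (n + 1))
    (by
      rw [hf', hcneg]
      exact ⟨P, hP, hPv⟩)
  obtain ⟨A, hA⟩ := exists_numerator hQ hQw
  have h2 := (represents_of_ae_eq f hr).add (represents_negPart hQr hA)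
  rw [show fcoeff f = c from hf', hc, sub_add_cancel] at h2
  exact ⟨_, h2⟩

/-! ### Symbols of block Toeplitz matrices -/

variable {m : ℕ} {Ω : Matrix (Fin m) (Fin m) (RatFunc ℂ)}

/-- Summability lets the image of `z ^ j w` be built directly as an absolutely convergent series, so
no boundedness of the Riesz projection enters. -/
theorem exists_mem_toeplitzGraph_monomialVec {b : Fin m → Fin m → ℤ → ℂ}
    (hΩ : ∀ i c, Represents p (Ω i c) (b i c)) (hb : ∀ i c, Summable fun n : ℕ => b i c n)
    (j : ℕ) (w : Fin m → ℂ) : ∃ g : HardyVec p m, (monomialVec p j w, g) ∈ toeplitzGraph p Ω ∧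
      ∀ (n : ℕ) (i : Fin m), fcoeff (g i : LpT p) n = ∑ c, b i c ((n : ℤ) - j) * w c := by
  choose h s hs he hf using fun i c => hΩ i c j
  have hsum : ∀ i, Summable fun n : ℕ => ∑ c, b i c ((n : ℤ) - j) * w c := by
    intro i
    refine summable_sum fun c _ => Summable.mul_right _ ((summable_nat_add_iff j).1 ?_)
    simpa using hb i c
  choose g hg using fun i => exists_hardy_fcoeff_eq p (hsum i)
  refine ⟨g, ⟨fun i => ∑ c, w c • h i c, fun i => ∑ c, RatFunc.C (w c) * s i c,
    fun i => IsRatZeroCircle.sum _ fun c _ => (hs i c).C_mul _, fun i => ?_, fun i n hn => ?_⟩,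
    fun n i => hg i n⟩
  · have h1 : ∀ᵐ t ∂arc, ∀ c, ((monomialVec p j w c : Hardy p) : LpT p) t
        = w c * fourier (j : ℤ) t := by
      rw [ae_all_iff]
      intro c
      filter_upwards [Lp.coeFn_smul (w c) (fourierLp p (j : ℤ)), coeFn_fourierLp p (j : ℤ)]
        with t h2 h3
      rw [Pi.smul_apply, h3, smul_eq_mul] at h2
      exact h2
    have h4 : ∀ᵐ t ∂arc, ∀ c, reval (RatFunc.C (w c) * s i c) (pt t)
        = w c * reval (s i c) (pt t) := ae_all_iff.2 fun c => reval_C_mul_ae _ _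
    have h5 : ∀ᵐ t ∂arc, ∀ c, (w c • h i c : LpT p) t = w c * h i c t :=
      ae_all_iff.2 fun c => Lp.coeFn_smul _ _
    filter_upwards [h1, h4, h5, ae_all_iff.2 (he i), reval_sum_ae Finset.univ
      (fun c => RatFunc.C (w c) * s i c), Lp.coeFn_finsetSum Finset.univ (fun c => w c • h i c)]
      with t k1 k2 k3 k4 k5 k6
    rw [k5, k6, Finset.sum_apply, ← Finset.sum_add_distrib]
    refine Finset.sum_congr rfl fun c _ => ?_
    rw [k1, k2, k3, mul_left_comm, k4]
    ring
  · obtain ⟨k, rfl⟩ := Int.eq_ofNat_of_zero_le hn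
    change fcoeff (g i : LpT p) (k : ℤ) = fcoeff (∑ c, w c • h i c) k
    rw [hg, ← fcoeffCLM_apply, map_sum]
    refine Finset.sum_congr rfl fun c _ => ?_
    rw [map_smul, fcoeffCLM_apply, hf, smul_eq_mul, mul_comm]

theorem hasBlockMatrix_of_represents {a : ℤ → Matrix (Fin m) (Fin m) ℂ}
    (hΩ : ∀ i c, Represents p (Ω i c) (fun n => a n i c))
    (ha : ∀ i c, Summable fun n : ℕ => a n i c) :
    HasBlockMatrix (toeplitzOp p Ω) (fun i j => a ((i : ℤ) - (j : ℤ))) := by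
  intro j w
  obtain ⟨g, hg, hc⟩ := exists_mem_toeplitzGraph_monomialVec hΩ ha j w
  obtain ⟨hdom, hT⟩ := (mem_toeplitzGraph_iff p Ω _ _).2 hg
  refine ⟨hdom, fun i k => ?_⟩
  rw [hT, hc]
  rfl

/-- The block matrix of an operator is unique. -/
theorem HasBlockMatrix.unique {T : HardyVec p m →ₗ.[ℂ] HardyVec p m}
    {s t : ℕ → ℕ → Matrix (Fin m) (Fin m) ℂ} (hs : HasBlockMatrix T s) (ht : HasBlockMatrix T t) :
    s = t := by
  funext i j
  ext k c
  obtain ⟨_, h1⟩ := hs j (Pi.single c 1)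
  obtain ⟨_, h2⟩ := ht j (Pi.single c 1)
  have h3 := (h1 i k).symm.trans (h2 i k)
  simpa using h3

end

/-! ### Entries and norms of matrices -/

theorem norm_entry_le {m : ℕ} (A : Matrix (Fin m) (Fin m) ℂ) (i c : Fin m) : ‖A i c‖ ≤ ‖A‖ := by
  have h1 := Matrix.l2_opNorm_mulVec A (EuclideanSpace.single c (1 : ℂ))
  rw [PiLp.norm_single, norm_one, mul_one] at h1
  refine le_trans ?_ ((PiLp.norm_apply_le _ i).trans h1)
  simp

theorem norm_le_sum_norm_entry {m : ℕ} (A : Matrix (Fin m) (Fin m) ℂ) :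
    ‖A‖ ≤ ∑ i, ∑ c, ‖A i c‖ * ‖Matrix.single i c (1 : ℂ)‖ := by
  conv_lhs => rw [Matrix.matrix_eq_sum_single A]
  refine (norm_sum_le _ _).trans (Finset.sum_le_sum fun i _ =>
    (norm_sum_le _ _).trans (Finset.sum_le_sum fun c _ => ?_))
  rw [← norm_smul, Matrix.smul_single, smul_eq_mul, mul_one]

theorem norm_mem_polyGrowth {m : ℕ} {A : ℕ → Matrix (Fin m) (Fin m) ℂ}
    (h : ∀ i c, (fun n => A n i c) ∈ polyGrowth) : (fun n => ((‖A n‖ : ℝ) : ℂ)) ∈ polyGrowth := by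
  have h1 : (∑ i, ∑ c, fun n => ((‖A n i c‖ * ‖Matrix.single i c (1 : ℂ)‖ : ℝ) : ℂ))
      ∈ polyGrowth := by
    refine Submodule.sum_mem _ fun i _ => Submodule.sum_mem _ fun c _ => ?_
    obtain ⟨M, C, hC⟩ := h i c
    refine ⟨M, C * ‖(Matrix.single i c (1 : ℂ) : Matrix (Fin m) (Fin m) ℂ)‖, fun n => ?_⟩
    rw [Complex.norm_real, Real.norm_of_nonneg (by positivity), mul_right_comm]
    exact mul_le_mul_of_nonneg_right (hC n) (norm_nonneg _)
  obtain ⟨M, C, hC⟩ := h1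
  refine ⟨M, C, fun n => le_trans ?_ (hC n)⟩
  rw [Complex.norm_real, norm_norm]
  refine (norm_le_sum_norm_entry (A n)).trans (le_of_eq ?_)
  simp only [Finset.sum_apply]
  simp only [← Complex.ofReal_sum]
  rw [Complex.norm_real, Real.norm_of_nonneg (by positivity)]

/-! ### Binomial bounds -/

theorem exists_le_choose_of_mem_polyGrowth {u : ℕ → ℂ} (hu : u ∈ polyGrowth) :
    ∃ (M : ℕ) (K : ℝ), 1 ≤ M ∧ 0 < K ∧ ∀ n : ℕ, M - 1 ≤ n + 1 →
      ‖u n‖ ≤ K * ((n + 1).choose (M - 1) : ℝ) := by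
  obtain ⟨M, C, hC⟩ := hu
  refine ⟨M + 1, (|C| + 1) * (M.factorial * (M : ℝ) ^ M), by omega, ?_, fun n hn => ?_⟩
  · have h0 : (0 : ℝ) < (M : ℝ) ^ M := by
      rcases Nat.eq_zero_or_pos M with rfl | h
      · simp
      · positivity
    positivity
  rw [Nat.add_sub_cancel] at hn ⊢
  -- For `1 ≤ M ≤ n + 1` one has `n + 1 ≤ M (n + 2 - M)` and `(n + 2 - M) ^ M ≤ M! * (n + 1).choose
  -- M`.
  have h1 : ((n : ℝ) + 1) ^ M ≤ M.factorial * (M : ℝ) ^ M * ((n + 1).choose M : ℝ) := by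
    rcases Nat.eq_zero_or_pos M with rfl | hM
    · simp
    have h2 : n + 1 ≤ M * (n + 1 + 1 - M) := by
      obtain ⟨k, hk⟩ := Nat.exists_eq_add_of_le hn
      rw [show n + 1 + 1 - M = k + 1 by omega, hk]
      nlinarith
    have h3 : ((n : ℝ) + 1) ^ M ≤ (M : ℝ) ^ M * ((n + 1 + 1 - M : ℕ) : ℝ) ^ M := by
      rw [← mul_pow]
      refine pow_le_pow_left₀ (by positivity) ?_ M
      exact_mod_cast h2
    have h4 := Nat.pow_le_choose (α := ℝ) M (n + 1)
    rw [div_le_iff₀ (by positivity)] at h4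
    calc ((n : ℝ) + 1) ^ M ≤ (M : ℝ) ^ M * ((n + 1 + 1 - M : ℕ) : ℝ) ^ M := h3
      _ ≤ (M : ℝ) ^ M * (((n + 1).choose M : ℝ) * M.factorial) := by gcongr
      _ = _ := by ring
  calc ‖u n‖ ≤ C * ((n : ℝ) + 1) ^ M := hC n
    _ ≤ (|C| + 1) * ((n : ℝ) + 1) ^ M :=
      mul_le_mul_of_nonneg_right ((le_abs_self C).trans (by linarith)) (by positivity)
    _ ≤ (|C| + 1) * (M.factorial * (M : ℝ) ^ M * ((n + 1).choose M : ℝ)) := by gcongr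
    _ = _ := by ring

theorem mem_polyGrowth_of_le_choose {u : ℕ → ℂ} {M : ℕ} {K : ℝ} (hK : 0 < K)
    (h : ∀ n : ℕ, M ≤ n + 1 → ‖u n‖ ≤ K * ((n + 1).choose M : ℝ)) : u ∈ polyGrowth := by
  -- The sum absorbs the finitely many indices with `n + 1 < M`, where no bound is assumed.
  refine ⟨M, K + ∑ k ∈ Finset.range M, ‖u k‖, fun n => ?_⟩
  have h0 : 0 ≤ ∑ k ∈ Finset.range M, ‖u k‖ := Finset.sum_nonneg fun _ _ => norm_nonneg _
  have h1 : (1 : ℝ) ≤ ((n : ℝ) + 1) ^ M := one_le_pow₀ (by linarith [Nat.cast_nonneg (α := ℝ) n])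
  rw [add_mul]
  rcases le_or_gt M (n + 1) with hn | hn
  · have h2 : ((n + 1).choose M : ℝ) ≤ ((n : ℝ) + 1) ^ M := by
      exact_mod_cast Nat.choose_le_pow (n + 1) M
    have h3 := (h n hn).trans (mul_le_mul_of_nonneg_left h2 hK.le)
    have h4 : 0 ≤ (∑ k ∈ Finset.range M, ‖u k‖) * ((n : ℝ) + 1) ^ M := by positivity
    linarith
  · have h2 : ‖u n‖ ≤ ∑ k ∈ Finset.range M, ‖u k‖ :=
      Finset.single_le_sum (f := fun k => ‖u k‖) (fun _ _ => norm_nonneg _)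
        (Finset.mem_range.2 (by omega))
    have h3 := le_mul_of_one_le_right h0 h1
    have h4 : 0 ≤ K * ((n : ℝ) + 1) ^ M := by positivity
    linarith

/-- The existence of a rational symbol, entry by entry. -/
theorem exists_hasBlockMatrix_iff {p : ℝ≥0∞} [Fact (1 ≤ p)] (hp : p ≠ ∞) {m : ℕ}
    (a : ℤ → Matrix (Fin m) (Fin m) ℂ) :
    (∃ Ω : Matrix (Fin m) (Fin m) (RatFunc ℂ),
      HasBlockMatrix (toeplitzOp p Ω) (fun i j => a ((i : ℤ) - (j : ℤ)))) ↔
    ∀ i c, IsRationalSymbolSeq (fun n => a n i c) := by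
  constructor
  · rintro ⟨Ω, hΩ⟩
    choose b hb hb' using fun i c => exists_represents hp (Ω i c)
    have h1 : HasBlockMatrix (toeplitzOp p Ω)
        (fun i j => (fun n : ℤ => Matrix.of fun k c => b k c n) ((i : ℤ) - (j : ℤ))) :=
      hasBlockMatrix_of_represents (a := fun n => Matrix.of fun k c => b k c n) hb
        fun i c => (hb' i c).summable
    have h2 := hΩ.unique h1
    intro i c
    convert hb' i c using 1
    funext n
    -- Every integer is `i - j` with `i`, `j` its positive and negative parts, so the matrix
    -- determines the whole sequence.
    have h3 := congrFun (congrFun h2 n.toNat) (-n).toNat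
    have h4 : (n.toNat : ℤ) - ((-n).toNat : ℤ) = n := by omega
    simp only [h4] at h3
    rw [h3]
    rfl
  · intro h
    choose Ω hΩ using fun i c => (h i c).exists_represents (p := p)
    exact ⟨Ω, hasBlockMatrix_of_represents hΩ fun i c => (h i c).summable⟩

end ToeplitzLike

end

theorem theorem2p1 (p : ℝ≥0∞) [Fact (1 ≤ p)] (hp : 1 < p) (hp' : p ≠ ∞) (m : ℕ)
    (a : ℤ → Matrix (Fin m) (Fin m) ℂ) :
    (∃ Ω : Matrix (Fin m) (Fin m) (RatFunc ℂ),
      HasBlockMatrix (toeplitzOp p Ω) (fun i j => a ((i : ℤ) - (j : ℤ)))) ↔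
    (∃ f : Hardy p, ∀ j : ℕ, fcoeff (f : LpT p) (j : ℤ) = ((‖a (j : ℤ)‖ : ℝ) : ℂ)) ∧
    (∃ (M : ℕ) (K : ℝ), 1 ≤ M ∧ 0 < K ∧ ∀ j : ℕ, 1 ≤ j → M - 1 ≤ j →
      ‖a (-(j : ℤ))‖ ≤ K * (j.choose (M - 1) : ℝ)) ∧
    (∃ N : ℕ, ∀ k : ℕ, 1 ≤ k → (blockHankel (fun j => a (j : ℤ)) k).rank ≤ N) ∧
    (∃ N : ℕ, ∀ k : ℕ, 1 ≤ k → (blockHankel (fun j => a (-(j : ℤ))) k).rank ≤ N) := by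
  rw [exists_hasBlockMatrix_iff hp']
  constructor
  · intro h
    refine ⟨?_, ?_, ?_, ?_⟩
    · have h1 : Summable fun n : ℕ => ((‖a n‖ : ℝ) : ℂ) := by
        rw [Complex.summable_ofReal]
        refine Summable.of_nonneg_of_le (fun _ => norm_nonneg _)
          (fun n => norm_le_sum_norm_entry (a n)) ?_
        exact summable_sum fun i _ => summable_sum fun c _ => ((h i c).summable.norm.mul_right _)
      exact exists_hardy_fcoeff_eq p h1
    · obtain ⟨M, K, hM, hK, hbd⟩ := exists_le_choose_of_mem_polyGrowth
        (norm_mem_polyGrowth (A := fun n : ℕ => a (-((n : ℤ) + 1)))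
          fun i c => (h i c).polyGrowth_neg)
      refine ⟨M, K, hM, hK, fun j hj hMj => ?_⟩
      obtain ⟨n, rfl⟩ : ∃ n, j = n + 1 := ⟨j - 1, by omega⟩
      have h1 := hbd n hMj
      rw [Complex.norm_real, norm_norm] at h1
      exact_mod_cast h1
    · obtain ⟨N, hN⟩ := exists_rank_blockHankel_le (b := fun j : ℕ => a (j : ℤ))
        fun i c => by simpa using (h i c).recurrent_pos
      exact ⟨N, fun k _ => hN k⟩
    · obtain ⟨N, hN⟩ := exists_rank_blockHankel_le (b := fun j : ℕ => a (-(j : ℤ)))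
        fun i c => by simpa using (h i c).recurrent_neg
      exact ⟨N, fun k _ => hN k⟩
  · rintro ⟨⟨f, hf⟩, ⟨M, K, hM, hK, hbd⟩, ⟨N, hN⟩, ⟨N', hN'⟩⟩ i c
    have hpos := isRecurrent_of_rank_blockHankel_le hN i c
    have hneg := isRecurrent_of_rank_blockHankel_le hN' i c
    refine ⟨isRecurrent_summable_of_nat (c := fun n : ℕ => a n i c) hpos ?_, by simpa using hpos,
      by simpa using hneg, mem_polyGrowth_of_le_choose (M := M - 1) hK fun n hn => ?_⟩
    -- The `H^p` condition is used only through Riemann-Lebesgue: entries are bounded by norms that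
    -- tend to `0`, and recurrence upgrades this to summability.
    · have h1 := (tendsto_fcoeff hp' (f : LpT p)).comp
        (Nat.cast_injective (R := ℤ)).tendsto_cofinite
      rw [Nat.cofinite_eq_atTop] at h1
      refine squeeze_zero_norm (fun n => ?_) (by simpa using h1.norm)
      rw [hf, Complex.norm_real, norm_norm]
      exact norm_entry_le _ _ _
    · refine (norm_entry_le _ _ _).trans ?_
      exact_mod_cast hbd (n + 1) (by omega) hn
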